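/- Let $n\ge 1$. Let $Z_{A_n}$ be the space of real symmetric $n\times n$ matrices $y$ with $y_{ij}=0$ whenever $|i-j|>1$, with the Lebesgue measure $dy=\prod_{i=1}^{n}dy_{ii}\prod_{i=1}^{n-1}dy_{i,i+1}$, and let $I_{A_n}$ be its dual space, realised as the symmetric matrices $\eta$ of which only the coefficients $\eta_{ij}$ with $|i-j|\le 1$ are given, with the pairing $\operatorname{tr}(y\eta)=\sum_{|i-j|\le 1}y_{ij}\eta_{ij}$. Let $P_{A_n}\subset Z_{A_n}$ be the cone of positive definite matrices and $Q_{A_n}=\{\eta\in I_{A_n}:\operatorname{tr}(y\eta)>0\ \text{for all } y\in\overline{P_{A_n}}\setminus\{0\}\}$ its dual cone. Write $|\cdot|$ for the determinant and $y_{\{i:j\}}$ for the submatrix of $y$ with rows and columns $i,\dots,j$. For $1\le M\le n$ and $\underline s=(s_1,\dots,s_n)\in\mathbb R^n$, with $s_0=s_{n+1}=0$, put $$\Delta^{(M)}_{\underline s}(y)=\prod_{i=1}^{M-1}|y_{\{1:i\}}|^{s_i-s_{i+1}}\;|y|^{s_M}\prod_{i=M+1}^{n}|y_{\{i:n\}}|^{s_i-s_{i-1}}\qquad(y\in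 P_{A_n}),$$ $$\delta^{(M)}_{\underline s}(\eta)=\frac{\prod_{i=1}^{M-1}|\eta_{\{i:i+1\}}|^{s_i}\prod_{i=M+1}^{n}|\eta_{\{i-1:i\}}|^{s_i}}{\prod_{i=2}^{M-1}\eta_{ii}^{s_{i-1}}\cdot\eta_{MM}^{s_{M-1}-s_M+s_{M+1}}\cdot\prod_{i=M+1}^{n-1}\eta_{ii}^{s_{i+1}}}\qquad(\eta\in Q_{A_n}),$$ and let $\varphi_{A_1}(\eta)=\eta^{-1}$ and $\varphi_{A_n}(\eta)=\prod_{i=1}^{n-1}|\eta_{\{i:i+1\}}|^{-3/2}\prod_{i=2}^{n-1}\eta_{ii}$ for $n\ge2$. Theorem. For all $n\ge1$, all $1\le M\le n$, all $\underline s\in\mathbb R^n$ and all $\eta\in Q_{A_n}$, the integral $\int_{P_{A_n}}e^{-\operatorname{tr}(y\eta)}\Delta^{(M)}_{\underline s}(y)\,dy$ converges if and only if $s_i>-\frac32$ for all $i\ne M$ and $s_M>-1$. In this case $$\int_{P_{A_n}}e^{-\operatorname{tr}(y\eta)}\Delta^{(M)}_{\underline s}(y)\,dy=\pi^{(n-1)/2}\Bigl\{\prod_{i\ne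 M}\Gamma\bigl(s_i+\tfrac32\bigr)\Bigr\}\Gamma(s_M+1)\,\delta^{(M)}_{-\underline s}(\eta)\,\varphi_{A_n}(\eta).$$ As a corollary, the characteristic function $\varphi_{Q_{A_n}}$ of the cone $Q_{A_n}$, that is, the Laplace transform $\varphi_{Q_{A_n}}(\eta)=\int e^{-\operatorname{tr}(y\eta)}\,dy$ of the Lebesgue measure on the dual cone $\{y\in Z_{A_n}:\operatorname{tr}(y\eta')>0\ \text{for all }\eta'\in\overline{Q_{A_n}}\setminus\{0\}\}$ of $Q_{A_n}$, is a constant multiple of $\varphi_{A_n}$: for all $\eta\in Q_{A_n}$, $$\varphi_{Q_{A_n}}(\eta)=\Bigl(\frac{\pi}{2}\Bigr)^{n-1}\varphi_{A_n}(\eta).$$ -/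

import Mathlib

open MeasureTheory

noncomputable section

namespace PathCone

/-- `Z_{A_n}`: the real symmetric `n × n` matrices with `y i j = 0` unless `i = j` or `i`, `j` are
adjacent in the path `A_n`. The dual space `I_{A_n}` (symmetric matrices of which only the
coefficients on the diagonal and on the edges are given) is realised by the same matrices: the
coefficients that are not given are filled with `0`, and the pairing is `tr (y η)`. -/
def space (n : ℕ) : Submodule ℝ (Matrix (Fin n) (Fin n) ℝ) where
  carrier := {y | y.IsSymm ∧ ∀ i j, i ≠ j → ¬ (SimpleGraph.pathGraph n).Adj i j → y i j = 0}
  add_mem' := by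
    rintro a b ⟨ha, ha'⟩ ⟨hb, hb'⟩
    exact ⟨ha.add hb, fun i j h h' => by simp [ha' i j h h', hb' i j h h']⟩
  zero_mem' := ⟨Matrix.isSymm_zero, fun _ _ _ _ => rfl⟩
  smul_mem' := by
    rintro c a ⟨ha, ha'⟩
    exact ⟨ha.smul c, fun i j h h' => by simp [ha' i j h h']⟩

/-- The matrix in `Z_{A_n}` with diagonal coefficients `c.1` and edge coefficients `c.2`
(`c.2 k` stands at the positions `(k, k+1)` and `(k+1, k)`). By the two facts below this is a
parametrisation of `Z_{A_n}`, and the Lebesgue measure `dy = ∏ᵢ dy_{ii} ∏ᵢ dy_{i,i+1}` of `Z_{A_n}`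
is the product measure `volume` in these coordinates. -/
def ofCoords (n : ℕ) (c : (Fin n → ℝ) × (Fin (n - 1) → ℝ)) : Matrix (Fin n) (Fin n) ℝ :=
  fun i j =>
    if i = j then c.1 i
    else if h : i.val + 1 = j.val then c.2 ⟨i.val, by omega⟩
    else if h : j.val + 1 = i.val then c.2 ⟨j.val, by omega⟩
    else 0

theorem range_ofCoords (n : ℕ) : Set.range (ofCoords n) = space n := by
  ext y
  constructor
  · rintro ⟨c, rfl⟩
    refine ⟨?_, ?_⟩
    · ext i j
      simp only [Matrix.transpose_apply, ofCoords]
      by_cases hij : i = j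
      · subst hij; simp
      · have hji : ¬ j = i := fun h => hij h.symm
        simp only [hij, hji, if_false]
        split_ifs <;> first | rfl | omega
    · intro i j hij hadj
      rw [SimpleGraph.pathGraph_adj] at hadj
      push Not at hadj
      simp [ofCoords, hij, hadj.1, hadj.2]
  · rintro ⟨hs, hz⟩
    refine ⟨(fun i => y i i, fun k => y ⟨k.val, by omega⟩ ⟨k.val + 1, by omega⟩), ?_⟩
    ext i j
    simp only [ofCoords]
    split_ifs with h1 h2 h3
    · subst h1; rfl
    · congr 1; exact Fin.ext h2
    · rw [← hs.apply]
      congr 1; exact Fin.ext h3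
    · refine (hz i j h1 ?_).symm
      rw [SimpleGraph.pathGraph_adj]
      tauto

theorem ofCoords_injective (n : ℕ) : Function.Injective (ofCoords n) := by
  rintro ⟨d, o⟩ ⟨d', o'⟩ h
  refine Prod.ext (funext fun i => ?_) (funext fun k => ?_)
  · simpa [ofCoords] using congrFun (congrFun h i) i
  · have hk := congrFun (congrFun h ⟨k.val, by omega⟩) ⟨k.val + 1, by omega⟩
    simpa [ofCoords, Fin.ext_iff] using hk

/-- The cone `P_{A_n}` of positive definite matrices in `Z_{A_n}`. -/
def coneP (n : ℕ) : Set (Matrix (Fin n) (Fin n) ℝ) :=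
  {y | y ∈ space n ∧ y.PosDef}

/-- The (open) dual cone of `Ω` with respect to the pairing `tr (y η)`. -/
def dualCone {n : ℕ} (Ω : Set (Matrix (Fin n) (Fin n) ℝ)) : Set (Matrix (Fin n) (Fin n) ℝ) :=
  {η | η ∈ space n ∧ ∀ y ∈ closure Ω, y ≠ 0 → 0 < (y * η).trace}

/-- The cone `Q_{A_n}`, dual to `P_{A_n}`. -/
def coneQ (n : ℕ) : Set (Matrix (Fin n) (Fin n) ℝ) :=
  dualCone (coneP n)

/-- The characteristic function of a cone: the Laplace transform of the Lebesgue measure of the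
dual cone. -/
def characteristicFunction {n : ℕ} (Ω : Set (Matrix (Fin n) (Fin n) ℝ))
    (x : Matrix (Fin n) (Fin n) ℝ) : ℝ :=
  ∫ c in ofCoords n ⁻¹' dualCone Ω, Real.exp (-(ofCoords n c * x).trace)

/-- The determinant of the submatrix with rows and columns `a, a+1, …, b`
(vertices are numbered from `0` to `n - 1`). -/
def blockDet {n : ℕ} (A : Matrix (Fin n) (Fin n) ℝ) (a b : ℕ) : ℝ :=
  (A.submatrix (fun k : {k : Fin n // a ≤ k.val ∧ k.val ≤ b} => k.val)
    (fun k : {k : Fin n // a ≤ k.val ∧ k.val ≤ b} => k.val)).det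

/-- `s_{i-1}`, equal to `0` if `i` is the first vertex. -/
def prev {n : ℕ} (s : Fin n → ℝ) (i : Fin n) : ℝ :=
  if 0 < i.val then s ⟨i.val - 1, by omega⟩ else 0

/-- `s_{i+1}`, equal to `0` if `i` is the last vertex. -/
def next {n : ℕ} (s : Fin n → ℝ) (i : Fin n) : ℝ :=
  if h : i.val + 1 < n then s ⟨i.val + 1, h⟩ else 0

/-- The power function `Δ^{(M)}_s` on `P_{A_n}`. -/
def powerP {n : ℕ} (M : Fin n) (s : Fin n → ℝ) (y : Matrix (Fin n) (Fin n) ℝ) : ℝ :=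
  (∏ i with i < M, blockDet y 0 i.val ^ (s i - next s i)) * y.det ^ s M *
    ∏ i with M < i, blockDet y i.val (n - 1) ^ (s i - prev s i)

/-- The power function `δ^{(M)}_s` on `Q_{A_n}`. -/
def powerQ {n : ℕ} (M : Fin n) (s : Fin n → ℝ) (η : Matrix (Fin n) (Fin n) ℝ) : ℝ :=
  ((∏ i with i < M, blockDet η i.val (i.val + 1) ^ s i) *
      ∏ i with M < i, blockDet η (i.val - 1) i.val ^ s i) /
    ((∏ i with 0 < i.val ∧ i < M, η i i ^ prev s i) *
      η M M ^ (prev s M - s M + next s M) *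
      ∏ i with M < i ∧ i.val + 1 < n, η i i ^ next s i)

/-- The function `φ_{A_n}` on `Q_{A_n}` (the value for `n = 0` is irrelevant). -/
def phi : (n : ℕ) → Matrix (Fin n) (Fin n) ℝ → ℝ
  | 0, _ => 1
  | 1, η => (η 0 0)⁻¹
  | n + 2, η =>
    (∏ i : Fin (n + 1), blockDet η i.val (i.val + 1) ^ (-(3 / 2) : ℝ)) *
      ∏ i : Fin (n + 2) with i ≠ 0 ∧ i ≠ Fin.last (n + 1), η i i

end PathCone

end

/-!
The integral is computed by removing the vertices of the path one at a time, from the two ends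
towards `M`.

Let `M` not be the first vertex. For `y` in `P`, let `t` be the first diagonal coefficient, `x` the
first edge coefficient and `y'` the Schur complement of `t`; it is the matrix `y` without its first
row and column, with `x² / t` subtracted from its first coefficient. So `y'` lies in the space of the
shorter path, and `(t, x, y') ↦ y` (`consCoords`) is a change of coordinates that preserves Lebesgue
measure and identifies `P` with `{t > 0} × ℝ × P'` (`posDef_consCoords_iff`). In these coordinates
everything factors: the minors of `y` that contain the first vertex are `t` times those of `y'`, so
`Δ_s(y) = t ^ s₁ Δ_{s'}(y')` (`powerP_consCoords`), and
`tr (y η) = t η₁₁ + 2 x η₁₂ + (x² / t) η₂₂ + tr (y' η')`, where `η'` is `η` without its first row and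
column (`trace_mul_consCoords`). Integration over `x` is Gaussian and integration over `t` is a Gamma
integral, `lintegral_end_vertex`; the factor they contribute is the quotient of the right-hand sides
for the longer and the shorter path (`powerQ_succ`, `phi_succ`). If `M` is the first vertex of a path
with at least two vertices, the path is reversed first.

All integrands are nonnegative, so the computation is made with integrals in `[0, ∞]`, a divergent
Gamma integral having the value `∞` (`eGamma`). The resulting identity
`lintegral_laplaceIntegrand` contains both the criterion for convergence and the value. About `η` it
uses only that the diagonal coefficients and the `2 × 2` minors on the edges are positive
(`EdgePos`).

For the characteristic function of `Q`, the dual cone of `Q` is `P` (`dualCone_coneQ`): the matrices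
`v vᵀ`, cut down to the path (`band`), lie in the closure of `Q`, which shows that elements of the
dual are positive definite, and conversely `P` is open. The value is then the case `s = 0`.
-/

noncomputable section

namespace PathCone

/-! ### Adding a first vertex to the path -/

/-- The coordinates of the matrix obtained from the matrix `y'` with coordinates `c` by adding a
first vertex with diagonal coefficient `t` and edge coefficient `x`, arranged so that the Schur
complement of the coefficient `t` is `y'`. -/
def consCoords {n : ℕ} (t x : ℝ) (c : (Fin (n + 1) → ℝ) × (Fin n → ℝ)) :
    (Fin (n + 2) → ℝ) × (Fin (n + 1) → ℝ) :=
  (Fin.cons t (c.1 + Pi.single 0 (x ^ 2 / t)), Fin.cons x c.2)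

theorem ofCoords_consCoords_zero_zero {n : ℕ} (t x : ℝ) (c : (Fin (n + 1) → ℝ) × (Fin n → ℝ)) :
    ofCoords (n + 2) (consCoords t x c) 0 0 = t := by
  simp [ofCoords, consCoords]

theorem ofCoords_consCoords_zero_succ {n : ℕ} (t x : ℝ) (c : (Fin (n + 1) → ℝ) × (Fin n → ℝ))
    (j : Fin (n + 1)) :
    ofCoords (n + 2) (consCoords t x c) 0 j.succ = if j = 0 then x else 0 := by
  rcases Fin.eq_zero_or_eq_succ j with rfl | ⟨j, rfl⟩
  · simp [ofCoords, consCoords]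
  · simp [ofCoords, Fin.ext_iff]

theorem ofCoords_mem_space {n : ℕ} (c : (Fin n → ℝ) × (Fin (n - 1) → ℝ)) :
    ofCoords n c ∈ space n := by
  rw [← SetLike.mem_coe, ← range_ofCoords]
  exact Set.mem_range_self c

theorem ofCoords_symm {n : ℕ} (c : (Fin n → ℝ) × (Fin (n - 1) → ℝ)) (i j : Fin n) :
    ofCoords n c i j = ofCoords n c j i :=
  (ofCoords_mem_space c).1.apply j i

theorem ofCoords_consCoords_succ_zero {n : ℕ} (t x : ℝ) (c : (Fin (n + 1) → ℝ) × (Fin n → ℝ))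
    (j : Fin (n + 1)) :
    ofCoords (n + 2) (consCoords t x c) j.succ 0 = if j = 0 then x else 0 := by
  rw [ofCoords_symm, ofCoords_consCoords_zero_succ]

theorem ofCoords_consCoords_succ_succ {n : ℕ} (t x : ℝ) (c : (Fin (n + 1) → ℝ) × (Fin n → ℝ))
    (i j : Fin (n + 1)) :
    ofCoords (n + 2) (consCoords t x c) i.succ j.succ =
      ofCoords (n + 1) c i j + (if i = 0 then x else 0) * (if j = 0 then x else 0) / t := by
  by_cases hij : i = j
  · subst hij
    rcases Fin.eq_zero_or_eq_succ i with rfl | ⟨i, rfl⟩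
    · simp [ofCoords, consCoords, sq]
    · simp [ofCoords, consCoords]
  · have h : (if i = 0 then x else 0) * (if j = 0 then x else 0) / t = 0 := by
      by_cases h0 : i = 0
      · have : j ≠ 0 := fun h => hij (h0.trans h.symm)
        simp [this]
      · simp [h0]
    rw [h, add_zero]
    simp only [ofCoords, hij, Fin.succ_inj, if_false, consCoords, Fin.val_succ, add_left_inj]
    split_ifs with h1 h2
    · exact Fin.cons_succ (α := fun _ => ℝ) x c.2 ⟨i, by omega⟩
    · exact Fin.cons_succ (α := fun _ => ℝ) x c.2 ⟨j, by omega⟩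
    · rfl

theorem trace_mul_consCoords {n : ℕ} (t x : ℝ) (c : (Fin (n + 1) → ℝ) × (Fin n → ℝ))
    (η : Matrix (Fin (n + 2)) (Fin (n + 2)) ℝ) :
    (ofCoords (n + 2) (consCoords t x c) * η).trace =
      t * η 0 0 + x * (η 0 1 + η 1 0) + x ^ 2 / t * η 1 1 +
        (ofCoords (n + 1) c * η.submatrix Fin.succ Fin.succ).trace := by
  simp only [Matrix.trace, Matrix.diag, Matrix.mul_apply]
  rw [Fin.sum_univ_succ]
  simp only [Fin.sum_univ_succ (n := n + 1), ofCoords_consCoords_zero_zero,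
    ofCoords_consCoords_zero_succ, ofCoords_consCoords_succ_zero, ofCoords_consCoords_succ_succ,
    Matrix.submatrix_apply, ite_mul, zero_mul, mul_ite, mul_zero, ite_div, zero_div, add_mul,
    Finset.sum_add_distrib, Finset.sum_ite_eq', Finset.mem_univ, if_true, Fin.succ_zero_eq_one]
  ring

theorem dotProduct_consCoords {n : ℕ} {t : ℝ} (ht : t ≠ 0) (x : ℝ)
    (c : (Fin (n + 1) → ℝ) × (Fin n → ℝ)) (v : Fin (n + 2) → ℝ) :
    v ⬝ᵥ (ofCoords (n + 2) (consCoords t x c)).mulVec v =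
      t * (v 0 + x / t * v 1) ^ 2 +
        Fin.tail v ⬝ᵥ (ofCoords (n + 1) c).mulVec (Fin.tail v) := by
  simp only [dotProduct, Matrix.mulVec, Finset.mul_sum]
  rw [Fin.sum_univ_succ]
  simp only [Fin.sum_univ_succ (n := n + 1), ofCoords_consCoords_zero_zero,
    ofCoords_consCoords_zero_succ, ofCoords_consCoords_succ_zero, ofCoords_consCoords_succ_succ,
    ite_mul, zero_mul, mul_ite, mul_zero, ite_div, zero_div, add_mul, mul_add,
    Finset.sum_add_distrib, Finset.sum_ite_eq', Finset.mem_univ, if_true, Fin.succ_zero_eq_one,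
    Fin.tail]
  field_simp
  ring

theorem posDef_ofCoords_iff {n : ℕ} (c : (Fin n → ℝ) × (Fin (n - 1) → ℝ)) :
    (ofCoords n c).PosDef ↔ ∀ v : Fin n → ℝ, v ≠ 0 → 0 < v ⬝ᵥ (ofCoords n c).mulVec v := by
  rw [Matrix.posDef_iff_dotProduct_mulVec]
  simp only [star_trivial]
  refine and_iff_right ?_
  ext i j
  simpa using ofCoords_symm c j i

theorem posDef_consCoords_iff {n : ℕ} (t x : ℝ) (c : (Fin (n + 1) → ℝ) × (Fin n → ℝ)) :
    (ofCoords (n + 2) (consCoords t x c)).PosDef ↔ 0 < t ∧ (ofCoords (n + 1) c).PosDef := by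
  constructor
  · intro h
    have ht : 0 < t := by
      simpa [ofCoords_consCoords_zero_zero] using h.diag_pos (i := 0)
    refine ⟨ht, (posDef_ofCoords_iff (n := n + 1) c).2 fun v hv => ?_⟩
    -- the first coefficient of the test vector makes the completed square vanish
    have h1 := (posDef_ofCoords_iff (n := n + 2) _).1 h (Fin.cons (-(x / t * v 0)) v) (by
      intro h0
      apply hv
      ext i
      simpa using congrFun h0 i.succ)
    rw [dotProduct_consCoords ht.ne'] at h1
    have : (Fin.cons (-(x / t * v 0)) v : Fin (n + 2) → ℝ) 1 = v 0 := rfl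
    simpa [this, Fin.tail_cons] using h1
  · rintro ⟨ht, h⟩
    refine (posDef_ofCoords_iff (n := n + 2) _).2 fun v hv => ?_
    rw [dotProduct_consCoords ht.ne']
    by_cases hw : Fin.tail v = 0
    · have h1 : v 1 = 0 := congrFun hw 0
      have h0 : v 0 ≠ 0 := by
        intro h0
        apply hv
        ext i
        rcases Fin.eq_zero_or_eq_succ i with rfl | ⟨i, rfl⟩
        · exact h0
        · exact congrFun hw i
      rw [hw, h1]
      simp only [mul_zero, add_zero, Matrix.mulVec_zero, dotProduct_zero]
      positivity
    · have := (posDef_ofCoords_iff (n := n + 1) c).1 h _ hw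
      positivity

theorem ofCoords_mem_coneP {n : ℕ} (c : (Fin n → ℝ) × (Fin (n - 1) → ℝ)) :
    ofCoords n c ∈ coneP n ↔ (ofCoords n c).PosDef :=
  and_iff_right (ofCoords_mem_space c)

/-! ### Determinants of blocks -/

theorem det_sum_unit {ι : Type*} [Fintype ι] [DecidableEq ι] (B : Matrix (Unit ⊕ ι) (Unit ⊕ ι) ℝ)
    {t : ℝ} (ht : t ≠ 0) (hB : B (.inl ()) (.inl ()) = t) :
    B.det = t * (Matrix.of fun i j => B (.inr i) (.inr j) -
      B (.inr i) (.inl ()) * B (.inl ()) (.inr j) / t).det := by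
  have hdet : B.toBlocks₁₁.det = t := by simp [Matrix.toBlocks₁₁, hB]
  have hu : IsUnit B.toBlocks₁₁ := by
    rw [Matrix.isUnit_iff_isUnit_det, hdet]; exact ht.isUnit
  have : Invertible B.toBlocks₁₁ := hu.invertible
  conv_lhs => rw [← Matrix.fromBlocks_toBlocks B, Matrix.det_fromBlocks₁₁, hdet]
  congr 2
  ext i j
  have h1 : (⅟ B.toBlocks₁₁) () () = t⁻¹ := by
    have h := congrFun (congrFun (mul_invOf_self B.toBlocks₁₁) ()) ()
    simp [Matrix.mul_apply, Matrix.toBlocks₁₁, hB] at h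
    exact eq_inv_of_mul_eq_one_right h
  simp only [Matrix.of_apply, Matrix.sub_apply, Matrix.mul_apply, Finset.univ_unique,
    Finset.sum_singleton, PUnit.default_eq_unit, h1, Matrix.toBlocks₁₂, Matrix.toBlocks₂₁,
    Matrix.toBlocks₂₂]
  ring

theorem blockDet_congr {m n : ℕ} {A : Matrix (Fin m) (Fin m) ℝ} {B : Matrix (Fin n) (Fin n) ℝ}
    {a b a' b' : ℕ}
    (e : {k : Fin m // a ≤ k.val ∧ k.val ≤ b} ≃ {k : Fin n // a' ≤ k.val ∧ k.val ≤ b'})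
    (h : ∀ i j, A i.1 j.1 = B (e i).1 (e j).1) :
    blockDet A a b = blockDet B a' b' := by
  unfold blockDet
  rw [← Matrix.det_submatrix_equiv_self e]
  congr 1
  ext i j
  exact h i j

/-- The vertices `a + 1, …, b + 1` of the longer path, as vertices `a, …, b` of its tail. -/
def blockSucc (n a b : ℕ) : {k : Fin n // a ≤ k.val ∧ k.val ≤ b} ≃
    {k : Fin (n + 1) // a + 1 ≤ k.val ∧ k.val ≤ b + 1} where
  toFun k := ⟨k.1.succ, by simpa using k.2⟩
  invFun k := ⟨k.1.pred (fun h => by have := k.2.1; simp [h] at this), by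
    have := k.2; simp only [Fin.val_pred]; omega⟩
  left_inv k := by simp
  right_inv k := by simp

theorem blockDet_submatrix_succ {n : ℕ} (A : Matrix (Fin (n + 1)) (Fin (n + 1)) ℝ) (a b : ℕ) :
    blockDet (A.submatrix Fin.succ Fin.succ) a b = blockDet A (a + 1) (b + 1) :=
  blockDet_congr (blockSucc n a b) fun _ _ => rfl

/-- The vertices `0, …, b + 1` of the longer path: the first one, and the vertices of its tail. -/
def blockCons (n b : ℕ) : Unit ⊕ {k : Fin n // 0 ≤ k.val ∧ k.val ≤ b} ≃
    {k : Fin (n + 1) // 0 ≤ k.val ∧ k.val ≤ b + 1} where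
  toFun := Sum.elim (fun _ => ⟨0, by simp⟩) fun k => ⟨k.1.succ, by simpa using k.2⟩
  invFun k := if h : k.1 = 0 then .inl () else .inr ⟨k.1.pred h, by
    have := k.2; simp only [Fin.val_pred]; omega⟩
  left_inv k := by rcases k with k | k <;> simp
  right_inv k := by
    by_cases h : k.1 = 0
    · simp only [h, dite_true, Sum.elim_inl]; exact Subtype.ext h.symm
    · simp [h]

theorem blockDet_zero_succ {n : ℕ} (A : Matrix (Fin (n + 1)) (Fin (n + 1)) ℝ) (b : ℕ)
    (h0 : A 0 0 ≠ 0) :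
    blockDet A 0 (b + 1) = A 0 0 * blockDet (Matrix.of fun i j : Fin n =>
      A i.succ j.succ - A i.succ 0 * A 0 j.succ / A 0 0) 0 b := by
  unfold blockDet
  rw [← Matrix.det_submatrix_equiv_self (blockCons n b), det_sum_unit _ h0 rfl]
  rfl

theorem blockDet_zero_zero {n : ℕ} (A : Matrix (Fin (n + 1)) (Fin (n + 1)) ℝ) :
    blockDet A 0 0 = A 0 0 := by
  unfold blockDet
  have : Unique {k : Fin (n + 1) // 0 ≤ k.val ∧ k.val ≤ 0} :=
    ⟨⟨⟨0, by simp⟩⟩, fun k => Subtype.ext (Fin.ext (by simpa using k.2))⟩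
  rw [Matrix.det_unique, Matrix.submatrix_apply]
  have h : (default : {k : Fin (n + 1) // 0 ≤ k.val ∧ k.val ≤ 0}).1 = 0 :=
    Fin.ext (by simpa using (default : {k : Fin (n + 1) // 0 ≤ k.val ∧ k.val ≤ 0}).2)
  rw [h]

theorem blockDet_zero_one {n : ℕ} (A : Matrix (Fin (n + 2)) (Fin (n + 2)) ℝ) (h0 : A 0 0 ≠ 0) :
    blockDet A 0 1 = A 0 0 * A 1 1 - A 0 1 * A 1 0 := by
  rw [blockDet_zero_succ A 0 h0, blockDet_zero_zero]
  simp only [Matrix.of_apply, Fin.succ_zero_eq_one]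
  field_simp

theorem blockDet_zero_last {n : ℕ} (A : Matrix (Fin (n + 1)) (Fin (n + 1)) ℝ) :
    blockDet A 0 n = A.det := by
  unfold blockDet
  rw [← Matrix.det_submatrix_equiv_self (Equiv.subtypeUnivEquiv fun k : Fin (n + 1) =>
    (⟨Nat.zero_le _, Nat.lt_succ_iff.1 k.2⟩ : 0 ≤ k.val ∧ k.val ≤ n)) A]
  rfl

theorem blockDet_submatrix_rev {n : ℕ} (A : Matrix (Fin (n + 1)) (Fin (n + 1)) ℝ) {a b : ℕ}
    (ha : a ≤ n) (hb : b ≤ n) :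
    blockDet (A.submatrix Fin.rev Fin.rev) a b = blockDet A (n - b) (n - a) := by
  refine blockDet_congr ((Equiv.subtypeEquiv Fin.revPerm fun k => ?_)) fun _ _ => rfl
  simp only [Fin.revPerm_apply, Fin.val_rev]
  omega

theorem blockDet_consCoords_zero {n : ℕ} {t : ℝ} (ht : t ≠ 0) (x : ℝ)
    (c : (Fin (n + 1) → ℝ) × (Fin n → ℝ)) (b : ℕ) :
    blockDet (ofCoords (n + 2) (consCoords t x c)) 0 (b + 1) =
      t * blockDet (ofCoords (n + 1) c) 0 b := by
  rw [blockDet_zero_succ _ _ (by rwa [ofCoords_consCoords_zero_zero])]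
  simp only [ofCoords_consCoords_zero_zero, ofCoords_consCoords_zero_succ,
    ofCoords_consCoords_succ_zero, ofCoords_consCoords_succ_succ, add_sub_cancel_right]
  rfl

theorem blockDet_consCoords_succ {n : ℕ} (t x : ℝ)
    (c : (Fin (n + 1) → ℝ) × (Fin n → ℝ)) {a : ℕ} (ha : 1 ≤ a) (b : ℕ) :
    blockDet (ofCoords (n + 2) (consCoords t x c)) (a + 1) (b + 1) =
      blockDet (ofCoords (n + 1) c) a b := by
  rw [← blockDet_submatrix_succ]
  refine blockDet_congr (Equiv.refl _) fun i j => ?_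
  have h : i.1 ≠ 0 := fun h => by have := i.2.1; simp [h] at this; omega
  simp [ofCoords_consCoords_succ_succ, h]

theorem det_consCoords {n : ℕ} {t : ℝ} (ht : t ≠ 0) (x : ℝ)
    (c : (Fin (n + 1) → ℝ) × (Fin n → ℝ)) :
    (ofCoords (n + 2) (consCoords t x c)).det = t * (ofCoords (n + 1) c).det := by
  rw [← blockDet_zero_last, blockDet_consCoords_zero ht, blockDet_zero_last]

theorem blockDet_pos {n : ℕ} {A : Matrix (Fin n) (Fin n) ℝ} (hA : A.PosDef) (a b : ℕ) :
    0 < blockDet A a b :=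
  (hA.submatrix Subtype.val_injective).det_pos

/-! ### One-variable integrals with values in `[0, ∞]` -/

/-- The Gamma integral `∫₀^∞ t ^ (a - 1) e ^ (-t) dt` for real `a`, with the value `∞` where it
diverges. -/
def eGamma (a : ℝ) : ENNReal :=
  if 0 < a then ENNReal.ofReal (Real.Gamma a) else ⊤

theorem eGamma_ne_zero (a : ℝ) : eGamma a ≠ 0 := by
  unfold eGamma
  split_ifs with h
  · simpa using Real.Gamma_pos_of_pos h
  · simp

theorem eGamma_ne_top_iff (a : ℝ) : eGamma a ≠ ⊤ ↔ 0 < a := by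
  unfold eGamma
  split_ifs with h <;> simp [h]

theorem lintegral_rpow_mul_exp_neg_mul {r : ℝ} (hr : 0 < r) (a : ℝ) :
    ∫⁻ t in Set.Ioi (0 : ℝ), ENNReal.ofReal (t ^ (a - 1) * Real.exp (-(r * t))) =
      ENNReal.ofReal (r ^ (-a)) * eGamma a := by
  have hnn : ∀ᵐ t ∂(volume.restrict (Set.Ioi (0 : ℝ))), 0 ≤ t ^ (a - 1) * Real.exp (-(r * t)) :=
    (ae_restrict_iff' measurableSet_Ioi).2 (.of_forall fun t ht =>
      mul_nonneg (Real.rpow_nonneg (le_of_lt ht) _) (Real.exp_nonneg _))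
  by_cases ha : 0 < a
  · have hval := Real.integral_rpow_mul_exp_neg_mul_Ioi ha hr
    have hpos : 0 < (1 / r) ^ a * Real.Gamma a :=
      mul_pos (Real.rpow_pos_of_pos (by positivity) _) (Real.Gamma_pos_of_pos ha)
    have hint : IntegrableOn (fun t : ℝ => t ^ (a - 1) * Real.exp (-(r * t))) (Set.Ioi 0) := by
      by_contra h
      rw [integral_undef h] at hval
      exact hpos.ne hval
    rw [← ofReal_integral_eq_lintegral_ofReal hint hnn, hval, eGamma, if_pos ha,
      ENNReal.ofReal_mul (by positivity), one_div, Real.inv_rpow hr.le, Real.rpow_neg hr.le]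
  · rw [eGamma, if_neg ha, ENNReal.mul_top (by simpa using Real.rpow_pos_of_pos hr _)]
    by_contra htop
    have hint : IntegrableOn (fun t : ℝ => t ^ (a - 1) * Real.exp (-(r * t))) (Set.Ioo 0 1) := by
      refine IntegrableOn.mono_set (t := Set.Ioi 0) ⟨?_, ?_⟩ Set.Ioo_subset_Ioi_self
      · exact Measurable.aestronglyMeasurable (by fun_prop)
      · rw [hasFiniteIntegral_iff_ofReal hnn]
        exact lt_top_iff_ne_top.2 htop
    -- on `(0, 1)` the exponential is bounded below, so `t ^ (a - 1)` would be integrable at `0`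
    have h1 : IntegrableOn (fun t : ℝ => t ^ (a - 1)) (Set.Ioo 0 1) := by
      refine Integrable.mono' (hint.const_mul (Real.exp r))
        (Measurable.aestronglyMeasurable (by fun_prop)) ?_
      refine (ae_restrict_iff' measurableSet_Ioo).2 (.of_forall fun t ht => ?_)
      have htp : 0 ≤ t ^ (a - 1) := Real.rpow_nonneg ht.1.le _
      rw [Real.norm_of_nonneg htp]
      calc t ^ (a - 1) = t ^ (a - 1) * 1 := (mul_one _).symm
        _ ≤ t ^ (a - 1) * Real.exp (r - r * t) := by
          gcongr
          refine Real.one_le_exp ?_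
          nlinarith [ht.2]
        _ = Real.exp r * (t ^ (a - 1) * Real.exp (-(r * t))) := by
          rw [sub_eq_add_neg r, Real.exp_add]; ring
    rw [intervalIntegral.integrableOn_Ioo_rpow_iff one_pos] at h1
    linarith

theorem lintegral_exp_neg_quadratic {a : ℝ} (ha : 0 < a) (b : ℝ) :
    ∫⁻ x : ℝ, ENNReal.ofReal (Real.exp (-(a * x ^ 2 + 2 * b * x))) =
      ENNReal.ofReal (√(Real.pi / a) * Real.exp (b ^ 2 / a)) := by
  have h : ∀ x : ℝ, ENNReal.ofReal (Real.exp (-(a * x ^ 2 + 2 * b * x))) =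
      ENNReal.ofReal (Real.exp (b ^ 2 / a)) *
        ENNReal.ofReal (Real.exp (-a * (x + b / a) ^ 2)) := by
    intro x
    rw [← ENNReal.ofReal_mul (Real.exp_nonneg _), ← Real.exp_add]
    congr 2
    field_simp
    ring
  simp_rw [h]
  rw [lintegral_const_mul' _ _ ENNReal.ofReal_ne_top,
    lintegral_add_right_eq_self (fun x : ℝ => ENNReal.ofReal (Real.exp (-a * x ^ 2))),
    ← ofReal_integral_eq_lintegral_ofReal (integrable_exp_neg_mul_sq ha)
      (.of_forall fun _ => Real.exp_nonneg _), integral_gaussian,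
    ← ENNReal.ofReal_mul (Real.exp_nonneg _), mul_comm]

/-- The integral over the two coefficients that are attached to an end vertex of the path. -/
theorem lintegral_end_vertex {p b q : ℝ} (hq : 0 < q) (hd : 0 < p * q - b ^ 2) (s : ℝ) :
    ∫⁻ t in Set.Ioi (0 : ℝ), ∫⁻ x : ℝ,
        ENNReal.ofReal (t ^ s * Real.exp (-(t * p + 2 * b * x + x ^ 2 / t * q))) =
      ENNReal.ofReal (√Real.pi * (p * q - b ^ 2) ^ (-(s + 3 / 2)) * q ^ (s + 1)) *
        eGamma (s + 3 / 2) := by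
  have hr : 0 < (p * q - b ^ 2) / q := by positivity
  have h : ∀ t ∈ Set.Ioi (0 : ℝ), ∫⁻ x : ℝ,
      ENNReal.ofReal (t ^ s * Real.exp (-(t * p + 2 * b * x + x ^ 2 / t * q))) =
      ENNReal.ofReal (√(Real.pi / q)) * ENNReal.ofReal (t ^ (s + 3 / 2 - 1) *
        Real.exp (-((p * q - b ^ 2) / q * t))) := by
    intro t ht
    have ht : 0 < t := ht
    have h1 : ∀ x : ℝ, ENNReal.ofReal (t ^ s * Real.exp (-(t * p + 2 * b * x + x ^ 2 / t * q))) =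
        ENNReal.ofReal (t ^ s * Real.exp (-(t * p))) *
          ENNReal.ofReal (Real.exp (-(q / t * x ^ 2 + 2 * b * x))) := by
      intro x
      rw [← ENNReal.ofReal_mul (by positivity), mul_assoc (t ^ s), ← Real.exp_add]
      congr 3
      ring
    simp_rw [h1]
    rw [lintegral_const_mul' _ _ ENNReal.ofReal_ne_top,
      lintegral_exp_neg_quadratic (div_pos hq ht), ← ENNReal.ofReal_mul (by positivity),
      ← ENNReal.ofReal_mul (by positivity)]
    congr 1
    have h2 : √(Real.pi / (q / t)) = √(Real.pi / q) * t ^ (1 / 2 : ℝ) := by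
      rw [← Real.sqrt_eq_rpow, ← Real.sqrt_mul (by positivity)]
      congr 1
      field_simp
    have h3 : t ^ (s + 3 / 2 - 1) = t ^ s * t ^ (1 / 2 : ℝ) := by
      rw [← Real.rpow_add ht]; congr 1; ring
    have h4 : Real.exp (-((p * q - b ^ 2) / q * t)) =
        Real.exp (-(t * p)) * Real.exp (b ^ 2 / (q / t)) := by
      rw [← Real.exp_add]; congr 1; field_simp; ring
    rw [h2, h3, h4]
    ring
  rw [setLIntegral_congr_fun measurableSet_Ioi h, lintegral_const_mul' _ _ ENNReal.ofReal_ne_top,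
    lintegral_rpow_mul_exp_neg_mul hr, ← mul_assoc, ← ENNReal.ofReal_mul (by positivity)]
  congr 2
  rw [Real.div_rpow hd.le hq.le, Real.rpow_neg hq.le, div_inv_eq_mul,
    Real.sqrt_div' _ hq.le]
  have h5 : q ^ (s + 3 / 2) = q ^ (s + 1) * √q := by
    rw [Real.sqrt_eq_rpow, ← Real.rpow_add hq]; congr 1; ring
  rw [h5]
  have : √q ≠ 0 := by positivity
  field_simp

/-! ### Integration in the coordinates of the path -/

theorem lintegral_pi_succ {n : ℕ} {f : (Fin (n + 1) → ℝ) → ENNReal} (hf : Measurable f) :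
    ∫⁻ d, f d = ∫⁻ t : ℝ, ∫⁻ d : Fin n → ℝ, f (Fin.cons t d) := by
  have h := (volume_preserving_piFinSuccAbove (fun _ : Fin (n + 1) => ℝ) 0).symm
  rw [h.lintegral_map_equiv f, Measure.volume_eq_prod, lintegral_prod]
  · simp [MeasurableEquiv.piFinSuccAbove, Fin.insertNthEquiv]
  · exact (hf.comp (MeasurableEquiv.measurable _)).aemeasurable

theorem measurable_finCons {n : ℕ} {α : Type*} [MeasurableSpace α] {f : α → ℝ}
    {g : α → Fin n → ℝ} (hf : Measurable f) (hg : Measurable g) :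
    Measurable fun a => (Fin.cons (f a) (g a) : Fin (n + 1) → ℝ) := by
  refine measurable_pi_iff.2 fun i => ?_
  rcases Fin.eq_zero_or_eq_succ i with rfl | ⟨i, rfl⟩
  · simpa using hf
  · simpa using measurable_pi_iff.1 hg i

theorem lintegral_consCoords {n : ℕ} {F : (Fin (n + 2) → ℝ) × (Fin (n + 1) → ℝ) → ENNReal}
    (hF : Measurable F) :
    ∫⁻ c, F c = ∫⁻ t : ℝ, ∫⁻ x : ℝ, ∫⁻ c, F (consCoords t x c) := by
  have h1 : Measurable fun d : Fin (n + 2) → ℝ => ∫⁻ o : Fin (n + 1) → ℝ, F (d, o) :=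
    hF.lintegral_prod_right'
  rw [Measure.volume_eq_prod, lintegral_prod _ hF.aemeasurable, lintegral_pi_succ h1]
  congr 1
  ext t
  have h2 : Measurable fun z : (Fin (n + 1) → ℝ) × ℝ =>
      ∫⁻ o : Fin n → ℝ, F (Fin.cons t z.1, Fin.cons z.2 o) := by
    refine Measurable.lintegral_prod_right'
      (f := fun z : ((Fin (n + 1) → ℝ) × ℝ) × (Fin n → ℝ) =>
        F (Fin.cons t z.1.1, Fin.cons z.1.2 z.2)) (hF.comp ?_)
    exact (measurable_finCons measurable_const (by fun_prop)).prodMk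
      (measurable_finCons (by fun_prop) (by fun_prop))
  calc ∫⁻ d : Fin (n + 1) → ℝ, ∫⁻ o : Fin (n + 1) → ℝ, F (Fin.cons t d, o)
      = ∫⁻ d : Fin (n + 1) → ℝ, ∫⁻ x : ℝ, ∫⁻ o : Fin n → ℝ, F (Fin.cons t d, Fin.cons x o) := by
        congr 1
        ext d
        exact lintegral_pi_succ (hF.comp (by fun_prop))
    _ = ∫⁻ x : ℝ, ∫⁻ d : Fin (n + 1) → ℝ, ∫⁻ o : Fin n → ℝ, F (Fin.cons t d, Fin.cons x o) :=
        lintegral_lintegral_swap h2.aemeasurable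
    _ = ∫⁻ x : ℝ, ∫⁻ c, F (consCoords t x c) := by
        congr 1
        ext x
        have h3 : Measurable fun c : (Fin (n + 1) → ℝ) × (Fin n → ℝ) =>
            F (consCoords t x c) := by
          refine hF.comp ((measurable_finCons measurable_const ?_).prodMk
            (measurable_finCons measurable_const measurable_snd))
          fun_prop
        rw [Measure.volume_eq_prod, lintegral_prod _ h3.aemeasurable]
        exact (lintegral_add_right_eq_self
          (fun d : Fin (n + 1) → ℝ => ∫⁻ o : Fin n → ℝ, F (Fin.cons t d, Fin.cons x o)) _).symm

/-- The coordinates of the matrix read from the last vertex to the first one. -/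
def revCoords {n : ℕ} (c : (Fin (n + 1) → ℝ) × (Fin n → ℝ)) : (Fin (n + 1) → ℝ) × (Fin n → ℝ) :=
  (fun i => c.1 i.rev, fun i => c.2 i.rev)

theorem ofCoords_revCoords {n : ℕ} (c : (Fin (n + 1) → ℝ) × (Fin n → ℝ)) :
    ofCoords (n + 1) (revCoords c) = (ofCoords (n + 1) c).submatrix Fin.rev Fin.rev := by
  ext i j
  have hi := i.2
  have hj := j.2
  simp only [ofCoords, revCoords, Matrix.submatrix_apply, Fin.rev_inj, Fin.val_rev]
  split_ifs with h1 h2 h3 h4 h5 h6 h7 <;>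
    first
      | rfl
      | omega
      | (refine congrArg c.2 (Fin.ext ?_); simp only [Fin.val_rev]; omega)

theorem measurePreserving_comp_rev (n : ℕ) :
    MeasurePreserving (fun (d : Fin n → ℝ) (i : Fin n) => d i.rev) := by
  have he : (fun (d : Fin n → ℝ) (i : Fin n) => d i.rev) =
      MeasurableEquiv.piCongrLeft (fun _ : Fin n => ℝ) Fin.revPerm := by
    ext d i
    have := Equiv.piCongrLeft_apply_apply (fun _ : Fin n => ℝ) Fin.revPerm d i.rev
    rw [Fin.revPerm_apply, Fin.rev_rev] at this
    exact this.symm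
  rw [he]
  exact volume_measurePreserving_piCongrLeft (fun _ : Fin n => ℝ) Fin.revPerm

theorem lintegral_revCoords {n : ℕ} {F : (Fin (n + 1) → ℝ) × (Fin n → ℝ) → ENNReal}
    (hF : Measurable F) : ∫⁻ c, F (revCoords c) = ∫⁻ c, F c := by
  have h := (measurePreserving_comp_rev (n + 1)).prod (measurePreserving_comp_rev n)
  exact h.lintegral_comp hF

/-! ### The power functions under removal of the first vertex -/

theorem next_succ {n : ℕ} (s : Fin (n + 1) → ℝ) (i : Fin n) :
    next s i.succ = next (Fin.tail s) i := by
  simp only [next, Fin.val_succ, Nat.add_lt_add_iff_right]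
  rfl

theorem prev_succ {n : ℕ} (s : Fin (n + 1) → ℝ) (i : Fin n) : prev s i.succ = s i.castSucc := by
  simp [prev, Fin.castSucc, Fin.castAdd, Fin.castLE]

theorem next_castSucc {n : ℕ} (s : Fin (n + 1) → ℝ) (i : Fin n) :
    next s i.castSucc = s i.succ := by
  simp [next, Fin.succ]

theorem prev_zero {n : ℕ} (s : Fin (n + 1) → ℝ) : prev s 0 = 0 := by
  simp [prev]

theorem sum_sub_next {n : ℕ} (s : Fin (n + 1) → ℝ) (M : Fin (n + 1)) :
    ∑ i with i < M, (s i - next s i) = s 0 - s M := by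
  induction M using Fin.induction with
  | zero => simp
  | succ i ih =>
    have : (Finset.univ.filter fun j : Fin (n + 1) => j < i.succ) =
        insert i.castSucc (Finset.univ.filter fun j : Fin (n + 1) => j < i.castSucc) := by
      ext j
      simp only [Finset.mem_filter, Finset.mem_univ, true_and, Finset.mem_insert, Fin.lt_def,
        Fin.ext_iff, Fin.val_succ, Fin.val_castSucc]
      omega
    rw [this, Finset.sum_insert (by simp), ih, next_castSucc]
    ring

theorem powerP_consCoords {n : ℕ} {t : ℝ} (ht : 0 < t) (x : ℝ)
    {c : (Fin (n + 1) → ℝ) × (Fin n → ℝ)} (hc : (ofCoords (n + 1) c).PosDef)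
    (M : Fin (n + 1)) (s : Fin (n + 2) → ℝ) :
    powerP M.succ s (ofCoords (n + 2) (consCoords t x c)) =
      t ^ s 0 * powerP M (Fin.tail s) (ofCoords (n + 1) c) := by
  have hA : (∏ i with i < M.succ,
      blockDet (ofCoords (n + 2) (consCoords t x c)) 0 i.val ^ (s i - next s i)) =
      t ^ (s 0 - s M.succ) * ∏ i with i < M,
        blockDet (ofCoords (n + 1) c) 0 i.val ^ (Fin.tail s i - next (Fin.tail s) i) := by
    rw [Finset.prod_filter, Fin.prod_univ_succ, if_pos (Fin.succ_pos M)]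
    simp only [Fin.succ_lt_succ_iff, Fin.val_succ, next_succ, blockDet_consCoords_zero ht.ne']
    rw [← Finset.prod_filter]
    have h0 : blockDet (ofCoords (n + 2) (consCoords t x c)) 0 (0 : Fin (n + 2)).val = t := by
      rw [Fin.val_zero, blockDet_zero_zero, ofCoords_consCoords_zero_zero]
    have h1 : next s 0 = Fin.tail s 0 := next_castSucc s 0
    have h2 : ∀ i : Fin (n + 1), (t * blockDet (ofCoords (n + 1) c) 0 i.val) ^
        (s i.succ - next (Fin.tail s) i) = t ^ (Fin.tail s i - next (Fin.tail s) i) *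
        blockDet (ofCoords (n + 1) c) 0 i.val ^ (Fin.tail s i - next (Fin.tail s) i) := fun i =>
      Real.mul_rpow ht.le (blockDet_pos hc _ _).le
    simp only [h2, Finset.prod_mul_distrib]
    rw [← Real.rpow_sum_of_pos ht, sum_sub_next, ← mul_assoc, h0, h1, ← Real.rpow_add ht]
    congr 2
    simp [Fin.tail]
  have hB : (∏ i with M.succ < i,
      blockDet (ofCoords (n + 2) (consCoords t x c)) i.val (n + 2 - 1) ^ (s i - prev s i)) =
      ∏ i with M < i, blockDet (ofCoords (n + 1) c) i.val (n + 1 - 1) ^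
        (Fin.tail s i - prev (Fin.tail s) i) := by
    rw [Finset.prod_filter, Fin.prod_univ_succ, if_neg (Fin.not_lt_zero _), one_mul]
    simp only [Fin.succ_lt_succ_iff, Fin.val_succ, prev_succ]
    rw [← Finset.prod_filter]
    refine Finset.prod_congr rfl fun i hi => ?_
    have hi : M < i := (Finset.mem_filter.1 hi).2
    obtain ⟨j, rfl⟩ := Fin.exists_succ_eq.2 (Fin.ne_zero_of_lt hi)
    have := blockDet_consCoords_succ t x c (a := j.succ.val) (by simp) n
    rw [prev_succ]
    simp only [Nat.add_sub_cancel, show n + 2 - 1 = n + 1 from rfl, this]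
    rfl
  unfold powerP
  rw [hA, hB, det_consCoords ht.ne', Real.mul_rpow ht.le hc.det_pos.le]
  have : t ^ s 0 = t ^ (s 0 - s M.succ) * t ^ s M.succ := by
    rw [← Real.rpow_add ht, sub_add_cancel]
  rw [this]
  simp only [Fin.tail]
  ring

theorem powerQ_succ {n : ℕ} {η : Matrix (Fin (n + 2)) (Fin (n + 2)) ℝ} (hq : 0 < η 1 1)
    (M : Fin (n + 1)) (s : Fin (n + 2) → ℝ) :
    powerQ M.succ s η = blockDet η 0 1 ^ s 0 * η 1 1 ^ (-s 0) *
      powerQ M (Fin.tail s) (η.submatrix Fin.succ Fin.succ) := by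
  have hA : (∏ i with i < M.succ, blockDet η i.val (i.val + 1) ^ s i) =
      blockDet η 0 1 ^ s 0 * ∏ i with i < M,
        blockDet (η.submatrix Fin.succ Fin.succ) i.val (i.val + 1) ^ Fin.tail s i := by
    rw [Finset.prod_filter, Fin.prod_univ_succ, if_pos (Fin.succ_pos M), Finset.prod_filter]
    simp only [Fin.succ_lt_succ_iff, Fin.val_succ, blockDet_submatrix_succ]
    rfl
  have hB : (∏ i with M.succ < i, blockDet η (i.val - 1) i.val ^ s i) =
      ∏ i with M < i,
        blockDet (η.submatrix Fin.succ Fin.succ) (i.val - 1) i.val ^ Fin.tail s i := by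
    rw [Finset.prod_filter, Fin.prod_univ_succ, if_neg (Fin.not_lt_zero _), one_mul]
    simp only [Fin.succ_lt_succ_iff, Fin.val_succ, blockDet_submatrix_succ]
    rw [← Finset.prod_filter]
    refine Finset.prod_congr rfl fun i hi => ?_
    have hi : M < i := (Finset.mem_filter.1 hi).2
    obtain ⟨j, rfl⟩ := Fin.exists_succ_eq.2 (Fin.ne_zero_of_lt hi)
    rfl
  have hC : (∏ i with M.succ < i ∧ i.val + 1 < n + 2, η i i ^ next s i) =
      ∏ i with M < i ∧ i.val + 1 < n + 1,
        (η.submatrix Fin.succ Fin.succ) i i ^ next (Fin.tail s) i := by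
    rw [Finset.prod_filter, Fin.prod_univ_succ, if_neg (fun h => Fin.not_lt_zero _ h.1), one_mul,
      Finset.prod_filter]
    simp only [Fin.succ_lt_succ_iff, Fin.val_succ, next_succ, Nat.add_lt_add_iff_right,
      Matrix.submatrix_apply]
  -- the extra factor comes from the vertex `1`, which is either `M` or an interior vertex
  have hD : (∏ i with 0 < i.val ∧ i < M.succ, η i i ^ prev s i) *
      η M.succ M.succ ^ (prev s M.succ - s M.succ + next s M.succ) =
      η 1 1 ^ s 0 * ((∏ i with 0 < i.val ∧ i < M,
        (η.submatrix Fin.succ Fin.succ) i i ^ prev (Fin.tail s) i) *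
      (η.submatrix Fin.succ Fin.succ) M M ^
        (prev (Fin.tail s) M - Fin.tail s M + next (Fin.tail s) M)) := by
    rw [Finset.prod_filter, Fin.prod_univ_succ, if_neg (by simp), one_mul, Finset.prod_filter]
    simp only [Fin.succ_lt_succ_iff, Fin.val_succ, next_succ, prev_succ, Nat.succ_pos', true_and,
      Matrix.submatrix_apply]
    rw [Fin.prod_univ_succ]
    rcases Fin.eq_zero_or_eq_succ M with rfl | ⟨M, rfl⟩
    · simp only [Fin.not_lt_zero, if_false, and_false, Finset.prod_const_one, one_mul, prev_zero,
        Fin.succ_zero_eq_one, Fin.castSucc_zero]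
      rw [← Real.rpow_add hq]
      congr 1
      simp [Fin.tail]
      ring
    · conv_rhs => rw [Fin.prod_univ_succ]
      simp only [Fin.succ_pos, if_true, Fin.succ_zero_eq_one, Fin.castSucc_zero, Fin.val_zero,
        lt_irrefl, false_and, if_false, one_mul, Fin.val_succ, Nat.succ_pos', true_and,
        prev_succ]
      rw [mul_assoc]
      rfl
  unfold powerQ
  rw [hA, hB, hC, hD, Real.rpow_neg hq.le]
  field_simp

theorem phi_succ {n : ℕ} {η : Matrix (Fin (n + 2)) (Fin (n + 2)) ℝ} (hq : 0 < η 1 1) :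
    phi (n + 2) η = blockDet η 0 1 ^ (-(3 / 2) : ℝ) * η 1 1 *
      phi (n + 1) (η.submatrix Fin.succ Fin.succ) := by
  cases n with
  | zero =>
    have : (Finset.univ.filter fun i : Fin 2 => i ≠ 0 ∧ i ≠ Fin.last 1) = ∅ := by decide
    simp only [phi, this]
    simp [hq.ne']
  | succ n =>
    have hA : (∏ i : Fin (n + 2), blockDet η i.val (i.val + 1) ^ (-(3 / 2) : ℝ)) =
        blockDet η 0 1 ^ (-(3 / 2) : ℝ) * ∏ i : Fin (n + 1),
          blockDet (η.submatrix Fin.succ Fin.succ) i.val (i.val + 1) ^ (-(3 / 2) : ℝ) := by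
      rw [Fin.prod_univ_succ]
      simp only [Fin.val_succ, blockDet_submatrix_succ]
      rfl
    have hB : (∏ i : Fin (n + 3) with i ≠ 0 ∧ i ≠ Fin.last (n + 2), η i i) =
        η 1 1 * ∏ i : Fin (n + 2) with i ≠ 0 ∧ i ≠ Fin.last (n + 1),
          (η.submatrix Fin.succ Fin.succ) i i := by
      have h1 : ¬ (Fin.succ 0 : Fin (n + 3)) = Fin.last (n + 2) := by simp [Fin.ext_iff]
      have h2 : ∀ i : Fin (n + 1), i.succ.succ = Fin.last (n + 2) ↔ i.succ = Fin.last (n + 1) :=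
        fun i => by simp [Fin.ext_iff]
      rw [Finset.prod_filter, Fin.prod_univ_succ, Fin.prod_univ_succ, Finset.prod_filter]
      conv_rhs => rw [Fin.prod_univ_succ]
      simp only [ne_eq, not_true, false_and, if_false, one_mul, Fin.succ_ne_zero,
        not_false_iff, true_and, h1, h2, if_true]
      rfl
    simp only [phi]
    rw [hA, hB]
    ring

/-! ### Reversal of the path -/

theorem prev_rev {n : ℕ} (s : Fin n → ℝ) (i : Fin n) :
    prev (fun j => s j.rev) i.rev = next s i := by
  have := i.2
  simp only [prev, next, Fin.val_rev]
  split_ifs with h1 h2 h2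
  · congr 1; ext; simp only [Fin.val_rev]; omega
  · omega
  · omega
  · rfl

theorem next_rev {n : ℕ} (s : Fin n → ℝ) (i : Fin n) :
    next (fun j => s j.rev) i.rev = prev s i := by
  have := i.2
  simp only [prev, next, Fin.val_rev]
  split_ifs with h1 h2 h2
  · congr 1; ext; simp only [Fin.val_rev]; omega
  · omega
  · omega
  · rfl

theorem prod_filter_rev {n : ℕ} (p : Fin n → Prop) [DecidablePred p] (f : Fin n → ℝ) :
    ∏ i with p i, f i = ∏ i : Fin n with p i.rev, f i.rev := by
  rw [Finset.prod_filter, Finset.prod_filter, ← Equiv.prod_comp Fin.revPerm]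
  rfl

theorem powerP_rev {n : ℕ} (M : Fin (n + 1)) (s : Fin (n + 1) → ℝ)
    (y : Matrix (Fin (n + 1)) (Fin (n + 1)) ℝ) :
    powerP M.rev (fun i => s i.rev) (y.submatrix Fin.rev Fin.rev) = powerP M s y := by
  unfold powerP
  have hd : (y.submatrix Fin.rev Fin.rev).det = y.det :=
    Matrix.det_submatrix_equiv_self Fin.revPerm y
  rw [prod_filter_rev (fun i => i < M.rev), prod_filter_rev (fun i => M.rev < i), hd]
  simp only [Fin.rev_lt_rev, Fin.rev_rev, next_rev, prev_rev]
  have h1 : ∀ i : Fin (n + 1), blockDet (y.submatrix Fin.rev Fin.rev) 0 i.rev.val =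
      blockDet y i.val (n + 1 - 1) := fun i => by
    rw [blockDet_submatrix_rev y (by omega) (by omega)]
    have := i.2
    congr 1; simp only [Fin.val_rev]; omega
  have h2 : ∀ i : Fin (n + 1), blockDet (y.submatrix Fin.rev Fin.rev) i.rev.val (n + 1 - 1) =
      blockDet y 0 i.val := fun i => by
    have := i.2
    rw [blockDet_submatrix_rev y (by omega) (by omega)]
    congr 1
    · omega
    · simp only [Fin.val_rev]; omega
  simp only [h1, h2]
  ring

theorem powerQ_rev {n : ℕ} (M : Fin (n + 1)) (s : Fin (n + 1) → ℝ)
    (η : Matrix (Fin (n + 1)) (Fin (n + 1)) ℝ) :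
    powerQ M.rev (fun i => s i.rev) (η.submatrix Fin.rev Fin.rev) = powerQ M s η := by
  unfold powerQ
  rw [prod_filter_rev (fun i => i < M.rev), prod_filter_rev (fun i => M.rev < i),
    prod_filter_rev (fun i => 0 < i.val ∧ i < M.rev),
    prod_filter_rev (fun i => M.rev < i ∧ i.val + 1 < n + 1)]
  simp only [Fin.rev_lt_rev, Fin.rev_rev, next_rev, prev_rev, Matrix.submatrix_apply]
  have h1 : (∏ i with M < i,
      blockDet (η.submatrix Fin.rev Fin.rev) i.rev.val (i.rev.val + 1) ^ s i) =
      ∏ i with M < i, blockDet η (i.val - 1) i.val ^ s i :=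
    Finset.prod_congr rfl fun i hi => by
      have hi : M.val < i.val := (Finset.mem_filter.1 hi).2
      have := i.2
      rw [blockDet_submatrix_rev η (by omega) (by simp only [Fin.val_rev]; omega)]
      congr 2 <;> simp only [Fin.val_rev] <;> omega
  have h2 : (∏ i with i < M,
      blockDet (η.submatrix Fin.rev Fin.rev) (i.rev.val - 1) i.rev.val ^ s i) =
      ∏ i with i < M, blockDet η i.val (i.val + 1) ^ s i :=
    Finset.prod_congr rfl fun i hi => by
      have hi : i.val < M.val := (Finset.mem_filter.1 hi).2
      have := M.2
      rw [blockDet_submatrix_rev η (by omega) (by omega)]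
      congr 2 <;> simp only [Fin.val_rev] <;> omega
  have h3 : ∀ i : Fin (n + 1), 0 < i.rev.val ↔ i.val + 1 < n + 1 := fun i => by
    simp only [Fin.val_rev]; omega
  have h4 : ∀ i : Fin (n + 1), i.rev.val + 1 < n + 1 ↔ 0 < i.val := fun i => by
    have := i.2
    simp only [Fin.val_rev]; omega
  simp only [h1, h2, h3, h4, and_comm]
  rw [show next s M - s M + prev s M = prev s M - s M + next s M by ring]
  congr 1 <;> ring

theorem phi_rev {n : ℕ} (η : Matrix (Fin (n + 1)) (Fin (n + 1)) ℝ) :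
    phi (n + 1) (η.submatrix Fin.rev Fin.rev) = phi (n + 1) η := by
  cases n with
  | zero => rfl
  | succ n =>
    simp only [phi]
    rw [prod_filter_rev (fun i : Fin (n + 2) => i ≠ 0 ∧ i ≠ Fin.last (n + 1)),
      ← Equiv.prod_comp Fin.revPerm]
    congr 1
    · refine Finset.prod_congr rfl fun i _ => ?_
      have := i.2
      rw [Fin.revPerm_apply, blockDet_submatrix_rev η (by omega) (by omega)]
      congr 2 <;> simp only [Fin.val_rev] <;> omega
    · simp only [Matrix.submatrix_apply, Fin.rev_rev]
      refine Finset.prod_congr (Finset.filter_congr fun i _ => ?_) fun _ _ => rfl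
      simp only [ne_eq, Fin.ext_iff, Fin.val_rev, Fin.val_zero, Fin.val_last]
      omega

/-! ### Measurability -/

theorem measurable_ofCoords_apply {n : ℕ} (i j : Fin n) :
    Measurable fun c : (Fin n → ℝ) × (Fin (n - 1) → ℝ) => ofCoords n c i j := by
  unfold ofCoords
  split_ifs <;> fun_prop

theorem measurable_det {ι α : Type*} [Fintype ι] [DecidableEq ι] [MeasurableSpace α]
    {A : α → Matrix ι ι ℝ} (hA : ∀ i j, Measurable fun a => A a i j) :
    Measurable fun a => (A a).det := by
  simp only [Matrix.det_apply']
  fun_prop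

theorem measurable_blockDet {n : ℕ} (a b : ℕ) :
    Measurable fun c => blockDet (ofCoords n c) a b :=
  measurable_det fun _ _ => measurable_ofCoords_apply _ _

theorem measurable_powerP {n : ℕ} (M : Fin n) (s : Fin n → ℝ) :
    Measurable fun c => powerP M s (ofCoords n c) := by
  unfold powerP
  refine ((Finset.measurable_prod _ fun i _ => ?_).mul ?_).mul
    (Finset.measurable_prod _ fun i _ => ?_)
  · exact (measurable_blockDet _ _).pow_const _
  · exact (measurable_det fun _ _ => measurable_ofCoords_apply _ _).pow_const _
  · exact (measurable_blockDet _ _).pow_const _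

theorem measurable_trace_mul {n : ℕ} (η : Matrix (Fin n) (Fin n) ℝ) :
    Measurable fun c => (ofCoords n c * η).trace := by
  simp only [Matrix.trace, Matrix.diag, Matrix.mul_apply]
  exact Finset.measurable_sum _ fun i _ => Finset.measurable_sum _ fun j _ =>
    (measurable_ofCoords_apply i j).mul_const _

theorem measurable_integrand {n : ℕ} (M : Fin n) (s : Fin n → ℝ) (η : Matrix (Fin n) (Fin n) ℝ) :
    Measurable fun c => Real.exp (-(ofCoords n c * η).trace) * powerP M s (ofCoords n c) :=
  (Real.measurable_exp.comp (measurable_trace_mul η).neg).mul (measurable_powerP M s)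

theorem posDef_ofCoords_one_iff (c : (Fin 1 → ℝ) × (Fin 0 → ℝ)) :
    (ofCoords 1 c).PosDef ↔ 0 < c.1 0 := by
  have : ofCoords 1 c = Matrix.diagonal c.1 := by
    ext i j
    rw [Subsingleton.elim i 0, Subsingleton.elim j 0]
    simp [ofCoords]
  rw [this, Matrix.posDef_diagonal_iff]
  simp

/-- The cone `P` is cut out by the positivity of the successive Schur pivots, which are measurable
functions of the coordinates. -/
theorem measurableSet_posDef (n : ℕ) :
    MeasurableSet {c : (Fin (n + 1) → ℝ) × (Fin n → ℝ) | (ofCoords (n + 1) c).PosDef} := by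
  induction n with
  | zero =>
    have : {c : (Fin 1 → ℝ) × (Fin 0 → ℝ) | (ofCoords 1 c).PosDef} = {c | 0 < c.1 0} :=
      Set.ext posDef_ofCoords_one_iff
    rw [this]
    exact measurableSet_lt measurable_const (by fun_prop)
  | succ n ih =>
    let g : (Fin (n + 2) → ℝ) × (Fin (n + 1) → ℝ) → (Fin (n + 1) → ℝ) × (Fin n → ℝ) := fun c =>
      (Fin.tail c.1 - Pi.single 0 (c.2 0 ^ 2 / c.1 0), Fin.tail c.2)
    have hg : Measurable g := by
      refine Measurable.prodMk (measurable_pi_iff.2 fun i => ?_)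
        (measurable_pi_iff.2 fun i => ?_)
      · simp only [Pi.sub_apply, Fin.tail, Pi.single_apply]
        split_ifs <;> fun_prop
      · simp only [Fin.tail]
        fun_prop
    have hc : ∀ c, consCoords (c.1 0) (c.2 0) (g c) = c := fun c => by
      simp only [consCoords, g, sub_add_cancel, Fin.cons_self_tail]
    have h : {c : (Fin (n + 2) → ℝ) × (Fin (n + 1) → ℝ) | (ofCoords (n + 2) c).PosDef} =
        {c | 0 < c.1 0} ∩ g ⁻¹' {c | (ofCoords (n + 1) c).PosDef} := by
      refine Set.ext fun c => ?_
      have := posDef_consCoords_iff (c.1 0) (c.2 0) (g c)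
      rw [hc] at this
      exact this
    rw [h]
    exact (measurableSet_lt measurable_const (by fun_prop)).inter (hg ih)

/-! ### The Laplace transform of the power function -/

/-- The matrix `η` is symmetric, and its diagonal coefficients and the determinants of its `2 × 2`
blocks on the edges are positive. Every element of the cone `Q` has this property; unlike membership
in `Q`, it passes at once to the shorter path and to the reversed one. -/
structure EdgePos {n : ℕ} (η : Matrix (Fin (n + 1)) (Fin (n + 1)) ℝ) : Prop where
  symm : ∀ i j, η i j = η j i
  diag : ∀ i, 0 < η i i
  edge : ∀ a < n, 0 < blockDet η a (a + 1)

theorem EdgePos.tail {n : ℕ} {η : Matrix (Fin (n + 2)) (Fin (n + 2)) ℝ} (h : EdgePos η) :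
    EdgePos (η.submatrix Fin.succ Fin.succ) where
  symm i j := h.symm _ _
  diag i := h.diag _
  edge a ha := by
    rw [blockDet_submatrix_succ]
    exact h.edge _ (by omega)

theorem EdgePos.rev {n : ℕ} {η : Matrix (Fin (n + 1)) (Fin (n + 1)) ℝ} (h : EdgePos η) :
    EdgePos (η.submatrix Fin.rev Fin.rev) where
  symm i j := h.symm _ _
  diag i := h.diag _
  edge a ha := by
    rw [blockDet_submatrix_rev _ (by omega) (by omega),
      show n - a = n - (a + 1) + 1 by omega]
    exact h.edge _ (by omega)

theorem EdgePos.powerQ_pos {n : ℕ} {η : Matrix (Fin (n + 1)) (Fin (n + 1)) ℝ} (h : EdgePos η)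
    (M : Fin (n + 1)) (s : Fin (n + 1) → ℝ) : 0 < powerQ M s η := by
  unfold powerQ
  refine div_pos (mul_pos ?_ ?_) (mul_pos (mul_pos ?_ (Real.rpow_pos_of_pos (h.diag _) _)) ?_)
  · refine Finset.prod_pos fun i hi => Real.rpow_pos_of_pos (h.edge _ ?_) _
    have : i.val < M.val := (Finset.mem_filter.1 hi).2
    omega
  · refine Finset.prod_pos fun i hi => Real.rpow_pos_of_pos ?_ _
    have hi : M.val < i.val := (Finset.mem_filter.1 hi).2
    have := h.edge (i.val - 1) (by omega)
    rwa [Nat.sub_add_cancel (by omega)] at this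
  · exact Finset.prod_pos fun i _ => Real.rpow_pos_of_pos (h.diag _) _
  · exact Finset.prod_pos fun i _ => Real.rpow_pos_of_pos (h.diag _) _

theorem EdgePos.phi_pos {n : ℕ} {η : Matrix (Fin (n + 1)) (Fin (n + 1)) ℝ} (h : EdgePos η) :
    0 < phi (n + 1) η := by
  cases n with
  | zero => exact inv_pos.2 (h.diag 0)
  | succ n =>
    exact mul_pos (Finset.prod_pos fun i _ => Real.rpow_pos_of_pos (h.edge _ i.2) _)
      (Finset.prod_pos fun i _ => h.diag i)

/-- The function `e ^ (-tr (y η)) Δ^{(M)}_s(y)`, extended by zero from the cone `P` to the whole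
space of coordinates. -/
def laplaceIntegrand {n : ℕ} (M : Fin (n + 1)) (s : Fin (n + 1) → ℝ)
    (η : Matrix (Fin (n + 1)) (Fin (n + 1)) ℝ) : (Fin (n + 1) → ℝ) × (Fin n → ℝ) → ENNReal :=
  {c | (ofCoords (n + 1) c).PosDef}.indicator fun c =>
    ENNReal.ofReal (Real.exp (-(ofCoords (n + 1) c * η).trace) * powerP M s (ofCoords (n + 1) c))

theorem laplaceIntegrand_of_posDef {n : ℕ} (M : Fin (n + 1)) (s : Fin (n + 1) → ℝ)
    (η : Matrix (Fin (n + 1)) (Fin (n + 1)) ℝ) {c : (Fin (n + 1) → ℝ) × (Fin n → ℝ)}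
    (hc : (ofCoords (n + 1) c).PosDef) :
    laplaceIntegrand M s η c = ENNReal.ofReal
      (Real.exp (-(ofCoords (n + 1) c * η).trace) * powerP M s (ofCoords (n + 1) c)) :=
  Set.indicator_of_mem (s := {c | (ofCoords (n + 1) c).PosDef}) hc _

theorem laplaceIntegrand_of_not_posDef {n : ℕ} (M : Fin (n + 1)) (s : Fin (n + 1) → ℝ)
    (η : Matrix (Fin (n + 1)) (Fin (n + 1)) ℝ) {c : (Fin (n + 1) → ℝ) × (Fin n → ℝ)}
    (hc : ¬ (ofCoords (n + 1) c).PosDef) : laplaceIntegrand M s η c = 0 :=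
  Set.indicator_of_notMem (s := {c | (ofCoords (n + 1) c).PosDef}) hc _

theorem measurable_laplaceIntegrand {n : ℕ} (M : Fin (n + 1)) (s : Fin (n + 1) → ℝ)
    (η : Matrix (Fin (n + 1)) (Fin (n + 1)) ℝ) : Measurable (laplaceIntegrand M s η) :=
  (measurable_integrand M s η).ennreal_ofReal.indicator (measurableSet_posDef n)

theorem lintegral_coneP_eq {n : ℕ} (M : Fin (n + 1)) (s : Fin (n + 1) → ℝ)
    (η : Matrix (Fin (n + 1)) (Fin (n + 1)) ℝ) :
    ∫⁻ c in ofCoords (n + 1) ⁻¹' coneP (n + 1), ENNReal.ofReal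
        (Real.exp (-(ofCoords (n + 1) c * η).trace) * powerP M s (ofCoords (n + 1) c)) =
      ∫⁻ c, laplaceIntegrand M s η c := by
  have : ofCoords (n + 1) ⁻¹' coneP (n + 1) = {c | (ofCoords (n + 1) c).PosDef} :=
    Set.ext ofCoords_mem_coneP
  rw [this]
  exact (lintegral_indicator (measurableSet_posDef n) _).symm

theorem powerP_pos {n : ℕ} (M : Fin n) (s : Fin n → ℝ) {y : Matrix (Fin n) (Fin n) ℝ}
    (hy : y.PosDef) : 0 < powerP M s y :=
  mul_pos (mul_pos (Finset.prod_pos fun _ _ => Real.rpow_pos_of_pos (blockDet_pos hy _ _) _)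
    (Real.rpow_pos_of_pos hy.det_pos _))
    (Finset.prod_pos fun _ _ => Real.rpow_pos_of_pos (blockDet_pos hy _ _) _)

theorem laplaceIntegrand_consCoords {n : ℕ} (M : Fin (n + 1)) (s : Fin (n + 2) → ℝ)
    {η : Matrix (Fin (n + 2)) (Fin (n + 2)) ℝ} (hη : η 1 0 = η 0 1) (t x : ℝ)
    (c : (Fin (n + 1) → ℝ) × (Fin n → ℝ)) :
    laplaceIntegrand M.succ s η (consCoords t x c) =
      (Set.Ioi 0).indicator (fun t : ℝ => ENNReal.ofReal
        (t ^ s 0 * Real.exp (-(t * η 0 0 + 2 * η 0 1 * x + x ^ 2 / t * η 1 1)))) t *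
      laplaceIntegrand M (Fin.tail s) (η.submatrix Fin.succ Fin.succ) c := by
  by_cases ht : 0 < t
  swap
  · rw [Set.indicator_of_notMem (show t ∉ Set.Ioi 0 from ht), zero_mul,
      laplaceIntegrand_of_not_posDef]
    exact fun h => ht ((posDef_consCoords_iff t x c).1 h).1
  by_cases hc : (ofCoords (n + 1) c).PosDef
  swap
  · rw [laplaceIntegrand_of_not_posDef _ _ _ hc, mul_zero, laplaceIntegrand_of_not_posDef]
    exact fun h => hc ((posDef_consCoords_iff t x c).1 h).2
  rw [laplaceIntegrand_of_posDef _ _ _ hc, laplaceIntegrand_of_posDef _ _ _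
    ((posDef_consCoords_iff t x c).2 ⟨ht, hc⟩), Set.indicator_of_mem (Set.mem_Ioi.2 ht),
    ← ENNReal.ofReal_mul (by positivity), trace_mul_consCoords, powerP_consCoords ht x hc, hη]
  congr 1
  have : Real.exp (-(t * η 0 0 + x * (η 0 1 + η 0 1) + x ^ 2 / t * η 1 1 +
      (ofCoords (n + 1) c * η.submatrix Fin.succ Fin.succ).trace)) =
      Real.exp (-(t * η 0 0 + 2 * η 0 1 * x + x ^ 2 / t * η 1 1)) *
        Real.exp (-(ofCoords (n + 1) c * η.submatrix Fin.succ Fin.succ).trace) := by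
    rw [← Real.exp_add]
    congr 1
    ring
  rw [this]
  ring

/-- Integrating out the first vertex when it is not `M`. The matrix `η` changes only by the loss of
its first row and column. -/
theorem lintegral_laplaceIntegrand_succ {n : ℕ} (M : Fin (n + 1)) (s : Fin (n + 2) → ℝ)
    {η : Matrix (Fin (n + 2)) (Fin (n + 2)) ℝ} (hη : EdgePos η) :
    ∫⁻ c, laplaceIntegrand M.succ s η c =
      ENNReal.ofReal (√Real.pi * blockDet η 0 1 ^ (-(s 0 + 3 / 2)) * η 1 1 ^ (s 0 + 1)) *
        eGamma (s 0 + 3 / 2) *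
        ∫⁻ c, laplaceIntegrand M (Fin.tail s) (η.submatrix Fin.succ Fin.succ) c := by
  have hd : blockDet η 0 1 = η 0 0 * η 1 1 - η 0 1 ^ 2 := by
    rw [blockDet_zero_one _ (hη.diag 0).ne', hη.symm 1 0, sq]
  rw [lintegral_consCoords (measurable_laplaceIntegrand _ _ _), hd,
    ← lintegral_end_vertex (hη.diag 1) (hd ▸ hη.edge 0 (by omega)),
    ← lintegral_indicator measurableSet_Ioi,
    ← lintegral_mul_const _ (Measurable.indicator ?_ measurableSet_Ioi)]
  · congr 1
    ext t
    simp_rw [laplaceIntegrand_consCoords M s (hη.symm 1 0)]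
    by_cases ht : t ∈ Set.Ioi (0 : ℝ)
    · simp only [Set.indicator_of_mem ht]
      rw [← lintegral_mul_const _ (by fun_prop)]
      congr 1
      ext x
      rw [lintegral_const_mul' _ _ ENNReal.ofReal_ne_top]
    · simp [Set.indicator_of_notMem ht]
  · refine Measurable.lintegral_prod_right' (f := fun z : ℝ × ℝ => ENNReal.ofReal
      (z.1 ^ s 0 * Real.exp (-(z.1 * η 0 0 + 2 * η 0 1 * z.2 + z.2 ^ 2 / z.1 * η 1 1)))) ?_
    fun_prop

theorem lintegral_laplaceIntegrand_rev {n : ℕ} (M : Fin (n + 1)) (s : Fin (n + 1) → ℝ)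
    (η : Matrix (Fin (n + 1)) (Fin (n + 1)) ℝ) :
    ∫⁻ c, laplaceIntegrand M.rev (fun i => s i.rev) (η.submatrix Fin.rev Fin.rev) c =
      ∫⁻ c, laplaceIntegrand M s η c := by
  rw [← lintegral_revCoords (measurable_laplaceIntegrand _ _ _)]
  congr 1
  ext c
  have h1 : (ofCoords (n + 1) (revCoords c)).PosDef ↔ (ofCoords (n + 1) c).PosDef := by
    rw [ofCoords_revCoords]
    refine ⟨fun h => ?_, fun h => h.submatrix Fin.rev_injective⟩
    have := h.submatrix Fin.rev_injective
    rwa [Matrix.submatrix_submatrix, Fin.rev_involutive.comp_self, Matrix.submatrix_id_id] at this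
  have h2 : ((ofCoords (n + 1) c).submatrix Fin.rev Fin.rev *
      η.submatrix Fin.rev Fin.rev).trace = (ofCoords (n + 1) c * η).trace := by
    have : (ofCoords (n + 1) c).submatrix Fin.rev Fin.rev * η.submatrix Fin.rev Fin.rev =
        (ofCoords (n + 1) c * η).submatrix Fin.rev Fin.rev :=
      Matrix.submatrix_mul_equiv (ofCoords (n + 1) c) η Fin.rev Fin.revPerm Fin.rev
    rw [this]
    exact Equiv.sum_comp Fin.revPerm fun i => (ofCoords (n + 1) c * η) i i
  by_cases hc : (ofCoords (n + 1) c).PosDef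
  · rw [laplaceIntegrand_of_posDef _ _ _ hc, laplaceIntegrand_of_posDef _ _ _ (h1.2 hc),
      ofCoords_revCoords, powerP_rev, h2]
  · rw [laplaceIntegrand_of_not_posDef _ _ _ hc,
      laplaceIntegrand_of_not_posDef _ _ _ fun h => hc (h1.1 h)]

theorem lintegral_laplaceIntegrand_one (s : Fin 1 → ℝ) {η : Matrix (Fin 1) (Fin 1) ℝ}
    (hη : 0 < η 0 0) :
    ∫⁻ c, laplaceIntegrand 0 s η c =
      ENNReal.ofReal (η 0 0 ^ (-(s 0 + 1))) * eGamma (s 0 + 1) := by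
  have h : ∀ (t : ℝ) (d o : Fin 0 → ℝ), laplaceIntegrand 0 s η (Fin.cons t d, o) =
      (Set.Ioi 0).indicator (fun t : ℝ => ENNReal.ofReal
        (t ^ (s 0 + 1 - 1) * Real.exp (-(η 0 0 * t)))) t := by
    intro t d o
    by_cases ht : 0 < t
    · rw [Set.indicator_of_mem (Set.mem_Ioi.2 ht),
        laplaceIntegrand_of_posDef _ _ _ ((posDef_ofCoords_one_iff _).2 ht)]
      have h1 : ofCoords 1 (Fin.cons t d, o) 0 0 = t := by simp [ofCoords]
      have h2 : powerP 0 s (ofCoords 1 (Fin.cons t d, o)) = t ^ s 0 := by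
        simp [powerP, h1, Finset.filter_singleton]
      have h3 : (ofCoords 1 (Fin.cons t d, o) * η).trace = η 0 0 * t := by
        simp [Matrix.trace, Matrix.mul_apply, h1, mul_comm]
      change ENNReal.ofReal (Real.exp (-(ofCoords 1 (Fin.cons t d, o) * η).trace) *
        powerP 0 s (ofCoords 1 (Fin.cons t d, o))) = _
      rw [h2, h3, add_sub_cancel_right, mul_comm]
    · rw [Set.indicator_of_notMem (show t ∉ Set.Ioi 0 from ht),
        laplaceIntegrand_of_not_posDef]
      exact fun h => ht ((posDef_ofCoords_one_iff _).1 h)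
  have hm : Measurable fun d : Fin 1 → ℝ => ∫⁻ o : Fin 0 → ℝ, laplaceIntegrand 0 s η (d, o) :=
    (measurable_laplaceIntegrand 0 s η).lintegral_prod_right'
  rw [← lintegral_rpow_mul_exp_neg_mul hη, ← lintegral_indicator measurableSet_Ioi,
    Measure.volume_eq_prod, lintegral_prod _ (measurable_laplaceIntegrand 0 s η).aemeasurable,
    lintegral_pi_succ hm]
  have hv : (volume : Measure (Fin 0 → ℝ)) Set.univ = 1 := by
    rw [volume_pi, Measure.pi_of_empty _ 0]
    simp
  simp only [h, lintegral_const, hv, mul_one]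

/-- The Laplace transform of the power function, with the value `∞` where the integral diverges. -/
theorem lintegral_laplaceIntegrand {n : ℕ} (M : Fin (n + 1)) (s : Fin (n + 1) → ℝ)
    {η : Matrix (Fin (n + 1)) (Fin (n + 1)) ℝ} (hη : EdgePos η) :
    ∫⁻ c, laplaceIntegrand M s η c =
      ENNReal.ofReal (√Real.pi ^ n * powerQ M (-s) η * phi (n + 1) η) *
        ((∏ i with i ≠ M, eGamma (s i + 3 / 2)) * eGamma (s M + 1)) := by
  induction n with
  | zero =>
    obtain rfl : M = 0 := Fin.fin_one_eq_zero M
    rw [lintegral_laplaceIntegrand_one s (hη.diag 0)]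
    have h1 : powerQ 0 (-s) η = η 0 0 ^ (-s 0) := by
      simp [powerQ, prev, next, Real.rpow_neg (hη.diag 0).le, Finset.filter_singleton]
    have h2 : (Finset.univ.filter fun i : Fin 1 => i ≠ 0) = ∅ := by decide
    have h3 : phi 1 η = η 0 0 ^ (-1 : ℝ) := (Real.rpow_neg_one _).symm
    have h4 : (0 : Fin (0 + 1)) = (0 : Fin 1) := rfl
    rw [h4, h1, h2, h3, pow_zero, one_mul, Finset.prod_empty, one_mul,
      ← Real.rpow_add (hη.diag 0)]
    congr 3
    ring
  | succ n ih =>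
    -- the case of an end vertex that is not `M`, to which the other case reduces by reversal
    have main : ∀ (M : Fin (n + 1)) (s : Fin (n + 2) → ℝ)
        {η : Matrix (Fin (n + 2)) (Fin (n + 2)) ℝ}, EdgePos η →
        ∫⁻ c, laplaceIntegrand M.succ s η c =
          ENNReal.ofReal (√Real.pi ^ (n + 1) * powerQ M.succ (-s) η * phi (n + 2) η) *
          ((∏ i with i ≠ M.succ, eGamma (s i + 3 / 2)) * eGamma (s M.succ + 1)) := by
      intro M s η hη
      have hq := hη.diag 1
      have hd : 0 < blockDet η 0 1 := hη.edge 0 (by omega)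
      have h1 : (∏ i with i ≠ M.succ, eGamma (s i + 3 / 2)) =
          eGamma (s 0 + 3 / 2) * ∏ i with i ≠ M, eGamma (Fin.tail s i + 3 / 2) := by
        rw [Finset.prod_filter, Fin.prod_univ_succ, if_pos (Fin.succ_ne_zero M).symm,
          Finset.prod_filter]
        simp only [ne_eq, Fin.succ_inj]
        rfl
      have h2 : √Real.pi ^ (n + 1) * powerQ M.succ (-s) η * phi (n + 2) η =
          (√Real.pi * blockDet η 0 1 ^ (-(s 0 + 3 / 2)) * η 1 1 ^ (s 0 + 1)) *
          (√Real.pi ^ n * powerQ M (-Fin.tail s) (η.submatrix Fin.succ Fin.succ) *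
            phi (n + 1) (η.submatrix Fin.succ Fin.succ)) := by
        rw [powerQ_succ hq, phi_succ hq, show -(s 0 + 3 / 2) = -s 0 + -(3 / 2) by ring,
          Real.rpow_add hd, Real.rpow_add hq, Real.rpow_one, Pi.neg_apply, neg_neg, pow_succ]
        have : Fin.tail (-s) = -Fin.tail s := rfl
        rw [this]
        ring
      rw [lintegral_laplaceIntegrand_succ M s hη, ih M (Fin.tail s) hη.tail, h1, h2,
        ENNReal.ofReal_mul
          (p := √Real.pi * blockDet η 0 1 ^ (-(s 0 + 3 / 2)) * η 1 1 ^ (s 0 + 1)) (by positivity)]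
      simp only [Fin.tail]
      ring
    rcases Fin.eq_zero_or_eq_succ M with rfl | ⟨M, rfl⟩
    · have h0 : (0 : Fin (n + 2)).rev = (Fin.last n).succ := by rw [Fin.rev_zero]; rfl
      have h1 : (∏ i with i ≠ (Fin.last n).succ, eGamma (s i.rev + 3 / 2)) =
          ∏ i : Fin (n + 2) with i ≠ 0, eGamma (s i + 3 / 2) := by
        rw [Finset.prod_filter, Finset.prod_filter, ← Equiv.prod_comp Fin.revPerm]
        refine Finset.prod_congr rfl fun i _ => ?_
        rw [Fin.revPerm_apply, Fin.rev_rev]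
        exact if_congr (by rw [← h0, ne_eq, Fin.rev_inj]) rfl rfl
      have h2 := powerQ_rev 0 (-s) η
      have h3 : (fun i => (-s) (Fin.rev i)) = -fun i => s i.rev := rfl
      have h4 : s (Fin.last n).succ.rev = s 0 := by rw [← h0, Fin.rev_rev]
      rw [h0, h3] at h2
      have h5 := lintegral_laplaceIntegrand_rev 0 s η
      rw [h0] at h5
      rw [← h5, main _ _ hη.rev, h1, h2, phi_rev, h4]
    · exact main M s hη

/-! ### Duality of the cones -/

/-- The symmetric matrix `v vᵀ` with the coefficients off the diagonal and the edges replaced by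
zero; on the space `Z_{A_n}` it represents the linear form `y ↦ vᵀ y v`. -/
def band {n : ℕ} (v : Fin n → ℝ) : Matrix (Fin n) (Fin n) ℝ :=
  Matrix.of fun i j => if i = j ∨ i.val + 1 = j.val ∨ j.val + 1 = i.val then v i * v j else 0

theorem band_mem_space {n : ℕ} (v : Fin n → ℝ) : band v ∈ space n := by
  refine ⟨?_, fun i j hij hadj => ?_⟩
  · ext i j
    simp only [Matrix.transpose_apply, band, Matrix.of_apply]
    refine if_congr ?_ (mul_comm _ _) rfl
    rw [eq_comm, or_comm (a := j.val + 1 = i.val)]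
  · rw [SimpleGraph.pathGraph_adj] at hadj
    simp only [band, Matrix.of_apply]
    rw [if_neg (by tauto)]

theorem trace_mul_band {n : ℕ} {y : Matrix (Fin n) (Fin n) ℝ} (hy : y ∈ space n)
    (v : Fin n → ℝ) : (y * band v).trace = v ⬝ᵥ y.mulVec v := by
  simp only [Matrix.trace, Matrix.diag, Matrix.mul_apply, dotProduct, Matrix.mulVec,
    Finset.mul_sum]
  refine Finset.sum_congr rfl fun i _ => Finset.sum_congr rfl fun j _ => ?_
  simp only [band, Matrix.of_apply]
  split_ifs with h
  · ring
  · rw [hy.2 i j (fun h' => h (Or.inl h'.symm)) (by rw [SimpleGraph.pathGraph_adj]; tauto)]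
    ring

theorem band_ne_zero {n : ℕ} {v : Fin n → ℝ} (hv : v ≠ 0) : band v ≠ 0 := by
  intro h
  apply hv
  ext i
  have := congrFun (congrFun h i) i
  simpa [band] using this

theorem one_mem_space (n : ℕ) : (1 : Matrix (Fin n) (Fin n) ℝ) ∈ space n :=
  ⟨Matrix.isSymm_one, fun _ _ h _ => Matrix.one_apply_ne h⟩

theorem isClosed_space (n : ℕ) : IsClosed (space n : Set (Matrix (Fin n) (Fin n) ℝ)) :=
  Submodule.closed_of_finiteDimensional _

theorem mem_closure_of_add_smul_one {n : ℕ} {Ω : Set (Matrix (Fin n) (Fin n) ℝ)}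
    {A : Matrix (Fin n) (Fin n) ℝ} (h : ∀ ε : ℝ, 0 < ε → A + ε • 1 ∈ Ω) : A ∈ closure Ω := by
  have hc : Continuous fun ε : ℝ => A + ε • (1 : Matrix (Fin n) (Fin n) ℝ) := by fun_prop
  have ht : Filter.Tendsto (fun ε : ℝ => A + ε • (1 : Matrix (Fin n) (Fin n) ℝ))
      (nhdsWithin 0 (Set.Ioi 0)) (nhds A) := by
    have := (hc.tendsto 0).mono_left (nhdsWithin_le_nhds (s := Set.Ioi 0))
    simpa using this
  exact mem_closure_of_tendsto ht (Filter.eventually_of_mem self_mem_nhdsWithin fun ε hε => h ε hε)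

theorem closure_coneP (n : ℕ) : closure (coneP n) = {y | y ∈ space n ∧ y.PosSemidef} := by
  refine Set.Subset.antisymm (closure_minimal (fun y hy => ⟨hy.1, hy.2.posSemidef⟩) ?_) ?_
  · have : {y : Matrix (Fin n) (Fin n) ℝ | y ∈ space n ∧ y.PosSemidef} =
        (space n : Set _) ∩ ⋂ v : Fin n → ℝ, {y | 0 ≤ v ⬝ᵥ y.mulVec v} := by
      ext y
      simp only [Set.mem_inter_iff, Set.mem_iInter, SetLike.mem_coe]
      refine and_congr_right fun hy => ?_
      change y.PosSemidef ↔ ∀ v : Fin n → ℝ, 0 ≤ v ⬝ᵥ y.mulVec v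
      rw [Matrix.posSemidef_iff_dotProduct_mulVec]
      simp only [star_trivial]
      exact and_iff_right (by rw [Matrix.IsHermitian, Matrix.conjTranspose_eq_transpose_of_trivial]
                              exact hy.1)
    rw [this]
    refine (isClosed_space n).inter (isClosed_iInter fun v => ?_)
    exact isClosed_le continuous_const (by fun_prop)
  · rintro y ⟨hy, hy'⟩
    refine mem_closure_of_add_smul_one fun ε hε => ⟨?_, ?_⟩
    · exact (space n).add_mem hy ((space n).smul_mem _ (one_mem_space n))
    · exact Matrix.PosDef.posSemidef_add hy' (Matrix.PosDef.one.smul hε)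

/-- If `v` is supported on the ends of an edge, `v vᵀ` lies in the space, so that an element of the
cone `Q` is positive at `v`. -/
theorem dotProduct_pos_of_mem_coneQ {n : ℕ} {η : Matrix (Fin n) (Fin n) ℝ} (hη : η ∈ coneQ n)
    {a : ℕ} {v : Fin n → ℝ} (hv : v ≠ 0)
    (hsupp : ∀ i : Fin n, v i ≠ 0 → a ≤ i.val ∧ i.val ≤ a + 1) :
    0 < v ⬝ᵥ η.mulVec v := by
  have hb : band v = Matrix.vecMulVec v (star v) := by
    ext i j
    simp only [band, Matrix.of_apply, Matrix.vecMulVec_apply, star_trivial]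
    split_ifs with h
    · rfl
    · by_contra hne
      have hi := hsupp i fun h0 => hne (by rw [h0, zero_mul])
      have hj := hsupp j fun h0 => hne (by rw [h0, mul_zero])
      rw [Fin.ext_iff] at h
      omega
  rw [← trace_mul_band hη.1, Matrix.trace_mul_comm]
  refine hη.2 _ ?_ (band_ne_zero hv)
  rw [closure_coneP]
  exact ⟨band_mem_space v, hb ▸ Matrix.posSemidef_vecMulVec_self_star v⟩

theorem edgePos_of_mem_coneQ {n : ℕ} {η : Matrix (Fin (n + 1)) (Fin (n + 1)) ℝ}
    (hη : η ∈ coneQ (n + 1)) : EdgePos η where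
  symm i j := hη.1.1.apply j i
  diag i := by
    have h := dotProduct_pos_of_mem_coneQ hη (a := i.val) (v := Pi.single i 1)
      (fun h => one_ne_zero (α := ℝ) (by simpa using congrFun h i)) (by
        intro j hj
        have : j = i := by
          by_contra hne
          exact hj (Pi.single_eq_of_ne hne _)
        subst this
        omega)
    simpa using h
  edge a _ := by
    refine Matrix.PosDef.det_pos (Matrix.posDef_iff_dotProduct_mulVec.2 ⟨?_, fun w hw => ?_⟩)
    · ext i j
      simpa using hη.1.1.apply i.1 j.1
    · set v : Fin (n + 1) → ℝ := Function.extend Subtype.val w (0 : Fin (n + 1) → ℝ)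
      have hval : ∀ k, v k.1 = w k := fun k => Subtype.val_injective.extend_apply w _ k
      have hout : ∀ i, i ∉ Set.range
          (Subtype.val : {k : Fin (n + 1) // a ≤ k.val ∧ k.val ≤ a + 1} → Fin (n + 1)) →
          v i = 0 := fun i hi => Function.extend_apply' w (0 : Fin (n + 1) → ℝ) i hi
      have h := dotProduct_pos_of_mem_coneQ hη (a := a) (v := v)
        (fun h0 => hw (funext fun k => by rw [← hval, h0]; rfl)) (fun i hi => by
          by_contra hne
          exact hi (hout i fun ⟨k, hk⟩ => hne (hk ▸ k.2)))
      refine h.trans_eq (Eq.symm ?_)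
      rw [star_trivial]
      refine Fintype.sum_of_injective _ Subtype.val_injective _ _
        (fun i hi => mul_eq_zero_of_left (hout i hi) _) fun k => ?_
      rw [hval]
      congr 1
      refine Fintype.sum_of_injective _ Subtype.val_injective _ _
        (fun i hi => mul_eq_zero_of_right _ (hout i hi)) fun l => ?_
      rw [hval]
      rfl

theorem exists_pos_sub_smul_posDef {n : ℕ} {y η : Matrix (Fin n) (Fin n) ℝ} (hy : y.PosDef)
    (hη : η.IsSymm) : ∃ ε : ℝ, 0 < ε ∧ (y - ε • η).PosDef := by
  have hc : Continuous fun z : ℝ × (Fin n → ℝ) => z.2 ⬝ᵥ (y - z.1 • η).mulVec z.2 := by fun_prop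
  have h : ∀ᶠ ε in nhds (0 : ℝ), ∀ v ∈ Metric.sphere (0 : Fin n → ℝ) 1,
      0 < v ⬝ᵥ (y - ε • η).mulVec v := by
    refine (isCompact_sphere (0 : Fin n → ℝ) 1).eventually_forall_of_forall_eventually
      (P := fun (ε : ℝ) v => 0 < v ⬝ᵥ (y - ε • η).mulVec v) fun v hv => ?_
    refine hc.continuousAt.eventually (lt_mem_nhds ?_)
    have hv0 : v ≠ 0 := fun h0 => by simp [h0] at hv
    simpa using hy.dotProduct_mulVec_pos hv0
  obtain ⟨ε, hε, h⟩ := ((h.filter_mono nhdsWithin_le_nhds).and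
    (self_mem_nhdsWithin (s := Set.Ioi (0 : ℝ)))).exists.imp fun ε h => And.intro h.2 h.1
  refine ⟨ε, hε, Matrix.posDef_iff_dotProduct_mulVec.2 ⟨?_, fun v hv => ?_⟩⟩
  · exact hy.isHermitian.sub (by
      rw [Matrix.IsHermitian, Matrix.conjTranspose_eq_transpose_of_trivial]
      exact hη.smul ε)
  · have hn : 0 < ‖v‖ := norm_pos_iff.2 hv
    have h1 := h (‖v‖⁻¹ • v) (by simp [norm_smul, hn.ne'])
    rw [Matrix.mulVec_smul, smul_dotProduct, dotProduct_smul, smul_eq_mul, smul_eq_mul] at h1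
    rw [star_trivial]
    exact pos_of_mul_pos_right (pos_of_mul_pos_right h1 (inv_nonneg.2 hn.le))
      (inv_nonneg.2 hn.le)

/-- The double dual of the open cone `P` in `Z_{A_n}` is `P`. -/
theorem dualCone_coneQ (n : ℕ) : dualCone (coneQ n) = coneP n := by
  ext z
  constructor
  · rintro ⟨hz, h⟩
    refine ⟨hz, Matrix.posDef_iff_dotProduct_mulVec.2 ⟨?_, fun v hv => ?_⟩⟩
    · rw [Matrix.IsHermitian, Matrix.conjTranspose_eq_transpose_of_trivial]
      exact hz.1
    · rw [star_trivial, ← trace_mul_band hz, Matrix.trace_mul_comm]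
      refine h _ (mem_closure_of_add_smul_one fun ε hε => ⟨?_, fun y hy hy0 => ?_⟩)
        (band_ne_zero hv)
      · exact (space n).add_mem (band_mem_space v) ((space n).smul_mem _ (one_mem_space n))
      · rw [closure_coneP] at hy
        have h1 : 0 ≤ v ⬝ᵥ y.mulVec v := by
          simpa using (Matrix.posSemidef_iff_dotProduct_mulVec.1 hy.2).2 v
        have h2 : 0 < y.trace := lt_of_le_of_ne hy.2.trace_nonneg
          fun h => hy0 (hy.2.trace_eq_zero_iff.1 h.symm)
        rw [mul_add, Matrix.trace_add, trace_mul_band hy.1, Matrix.mul_smul, mul_one,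
          Matrix.trace_smul, smul_eq_mul]
        positivity
  · rintro ⟨hz, hpd⟩
    refine ⟨hz, fun η hη hη0 => ?_⟩
    have hsub : closure (coneQ n) ⊆
        (space n : Set _) ∩ {η | ∀ y ∈ coneP n, 0 ≤ (y * η).trace} := by
      refine closure_minimal (fun η hη => ⟨hη.1, fun y hy => ?_⟩) ?_
      · by_cases hy0 : y = 0
        · simp [hy0]
        · exact (hη.2 y (subset_closure hy) hy0).le
      · refine (isClosed_space n).inter ?_
        simp only [Set.ofPred_forall]
        exact isClosed_biInter fun y _ => isClosed_le continuous_const (by fun_prop)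
    obtain ⟨hηs, hη'⟩ := hsub hη
    -- moving `z` inside the open cone against `η` gains the squared Frobenius norm of `η`
    obtain ⟨ε, hε, hpos⟩ := exists_pos_sub_smul_posDef hpd hηs.1
    have h1 := hη' (z - ε • η) ⟨(space n).sub_mem hz ((space n).smul_mem _ hηs), hpos⟩
    have h2 : 0 < (η * η).trace := by
      have hps := (Matrix.posSemidef_conjTranspose_mul_self η).trace_nonneg
      have he : η.conjTranspose = η := by
        rw [Matrix.conjTranspose_eq_transpose_of_trivial]; exact hηs.1
      rw [he] at hps
      refine lt_of_le_of_ne hps fun h => hη0 ?_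
      rw [← Matrix.trace_conjTranspose_mul_self_eq_zero_iff, he]
      exact h.symm
    rw [sub_mul, Matrix.trace_sub, Matrix.smul_mul, Matrix.trace_smul, smul_eq_mul] at h1
    rw [Matrix.trace_mul_comm]
    nlinarith [mul_pos hε h2]

/-! ### Convergence and value of the integral -/

theorem prod_mul_ne_top_iff {ι : Type*} {S : Finset ι} {f : ι → ENNReal} {b : ENNReal}
    (hf : ∀ i, f i ≠ 0) (hb : b ≠ 0) :
    (∏ i ∈ S, f i) * b ≠ ⊤ ↔ (∀ i ∈ S, f i ≠ ⊤) ∧ b ≠ ⊤ := by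
  refine ⟨fun h => ⟨fun i hi htop => h ?_, fun htop => h ?_⟩, fun h =>
    ENNReal.mul_ne_top (ENNReal.prod_ne_top h.1) h.2⟩
  · have : ∏ i ∈ S, f i = ⊤ := WithTop.prod_eq_top hi htop fun j _ => hf j
    rw [this]
    exact ENNReal.top_mul hb
  · rw [htop]
    exact ENNReal.mul_top (Finset.prod_ne_zero_iff.2 fun j _ => hf j)

theorem measurableSet_coneP (n : ℕ) : MeasurableSet (ofCoords (n + 1) ⁻¹' coneP (n + 1)) := by
  have : ofCoords (n + 1) ⁻¹' coneP (n + 1) = {c | (ofCoords (n + 1) c).PosDef} :=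
    Set.ext ofCoords_mem_coneP
  rw [this]
  exact measurableSet_posDef n

theorem integrand_nonneg_ae {n : ℕ} (M : Fin (n + 1)) (s : Fin (n + 1) → ℝ)
    (η : Matrix (Fin (n + 1)) (Fin (n + 1)) ℝ) :
    0 ≤ᵐ[volume.restrict (ofCoords (n + 1) ⁻¹' coneP (n + 1))] fun c =>
      Real.exp (-(ofCoords (n + 1) c * η).trace) * powerP M s (ofCoords (n + 1) c) :=
  (ae_restrict_iff' (measurableSet_coneP n)).2 (.of_forall fun _ hc =>
    mul_nonneg (Real.exp_nonneg _) (powerP_pos M s hc.2).le)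

/-- All factors of `lintegral_laplaceIntegrand` are nonzero, so that the integral is finite exactly
when each Gamma factor is. -/
theorem integrableOn_coneP_iff {n : ℕ} (M : Fin (n + 1)) (s : Fin (n + 1) → ℝ)
    {η : Matrix (Fin (n + 1)) (Fin (n + 1)) ℝ} (hη : EdgePos η) :
    IntegrableOn (fun c => Real.exp (-(ofCoords (n + 1) c * η).trace) *
        powerP M s (ofCoords (n + 1) c)) (ofCoords (n + 1) ⁻¹' coneP (n + 1)) ↔
      (∀ i, i ≠ M → -(3 / 2) < s i) ∧ -1 < s M := by
  have hpos : 0 < √Real.pi ^ n * powerQ M (-s) η * phi (n + 1) η :=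
    mul_pos (mul_pos (by positivity) (hη.powerQ_pos M _)) hη.phi_pos
  have h1 : IntegrableOn (fun c => Real.exp (-(ofCoords (n + 1) c * η).trace) *
        powerP M s (ofCoords (n + 1) c)) (ofCoords (n + 1) ⁻¹' coneP (n + 1)) ↔
      ∫⁻ c, laplaceIntegrand M s η c < ⊤ := by
    rw [← lintegral_coneP_eq, ← hasFiniteIntegral_iff_ofReal (integrand_nonneg_ae M s η)]
    exact and_iff_right (measurable_integrand M s η).aestronglyMeasurable
  have h2 : ∀ b : ENNReal,
      ENNReal.ofReal (√Real.pi ^ n * powerQ M (-s) η * phi (n + 1) η) * b < ⊤ ↔ b ≠ ⊤ := by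
    intro b
    rw [lt_top_iff_ne_top, ne_eq, ENNReal.mul_eq_top]
    simp [hpos]
  rw [h1, lintegral_laplaceIntegrand M s hη, h2,
    prod_mul_ne_top_iff (fun i => eGamma_ne_zero _) (eGamma_ne_zero _)]
  simp only [eGamma_ne_top_iff, Finset.mem_filter, Finset.mem_univ, true_and]
  refine and_congr (forall_congr' fun i => imp_congr_right fun _ => ?_) ?_ <;>
    constructor <;> intro h <;> linarith

theorem pi_rpow_half (n : ℕ) : Real.pi ^ ((((n + 1 : ℕ) : ℝ) - 1) / 2) = √Real.pi ^ n := by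
  rw [Real.sqrt_eq_rpow, ← Real.rpow_mul_natCast Real.pi_pos.le]
  congr 1
  push_cast
  ring

theorem integral_coneP {n : ℕ} (M : Fin (n + 1)) (s : Fin (n + 1) → ℝ)
    {η : Matrix (Fin (n + 1)) (Fin (n + 1)) ℝ} (hη : EdgePos η)
    (hs : (∀ i, i ≠ M → -(3 / 2) < s i) ∧ -1 < s M) :
    ∫ c in ofCoords (n + 1) ⁻¹' coneP (n + 1), Real.exp (-(ofCoords (n + 1) c * η).trace) *
        powerP M s (ofCoords (n + 1) c) =
      Real.pi ^ ((((n + 1 : ℕ) : ℝ) - 1) / 2) * (∏ i with i ≠ M, Real.Gamma (s i + 3 / 2)) *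
        Real.Gamma (s M + 1) * powerQ M (-s) η * phi (n + 1) η := by
  have hpos : 0 < √Real.pi ^ n * powerQ M (-s) η * phi (n + 1) η :=
    mul_pos (mul_pos (by positivity) (hη.powerQ_pos M _)) hη.phi_pos
  have hG : ∀ a : ℝ, 0 < a → (eGamma a).toReal = Real.Gamma a := fun a ha => by
    rw [eGamma, if_pos ha, ENNReal.toReal_ofReal (Real.Gamma_pos_of_pos ha).le]
  have hprod : (∏ i with i ≠ M, (eGamma (s i + 3 / 2)).toReal) =
      ∏ i with i ≠ M, Real.Gamma (s i + 3 / 2) :=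
    Finset.prod_congr rfl fun i hi => hG _ (by linarith [hs.1 i (Finset.mem_filter.1 hi).2])
  rw [integral_eq_lintegral_of_nonneg_ae (integrand_nonneg_ae M s η)
    (measurable_integrand M s η).aestronglyMeasurable, lintegral_coneP_eq,
    lintegral_laplaceIntegrand M s hη, ENNReal.toReal_mul, ENNReal.toReal_mul,
    ENNReal.toReal_prod, hprod, hG _ (by linarith [hs.2]), ENNReal.toReal_ofReal hpos.le,
    pi_rpow_half]
  ring

theorem characteristicFunction_coneQ {n : ℕ} {η : Matrix (Fin (n + 1)) (Fin (n + 1)) ℝ}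
    (hη : EdgePos η) :
    characteristicFunction (coneQ (n + 1)) η = (Real.pi / 2) ^ n * phi (n + 1) η := by
  have h := integral_coneP 0 0 hη ⟨fun i _ => by norm_num, by norm_num⟩
  have hP : ∀ y : Matrix (Fin (n + 1)) (Fin (n + 1)) ℝ, powerP 0 0 y = 1 := fun y => by
    simp [powerP, next, prev]
  have hQ : powerQ 0 (-0) η = 1 := by
    simp [powerQ, next, prev]
  have hG : Real.Gamma (3 / 2) = √Real.pi / 2 := by
    rw [show (3 / 2 : ℝ) = 1 / 2 + 1 by norm_num, Real.Gamma_add_one (by norm_num),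
      Real.Gamma_one_half_eq]
    ring
  have hcard : (Finset.univ.filter fun i : Fin (n + 1) => i ≠ 0).card = n := by
    rw [Finset.filter_ne', Finset.card_erase_of_mem (Finset.mem_univ _), Finset.card_univ,
      Fintype.card_fin, Nat.add_sub_cancel]
  simp only [hP, hQ, Pi.zero_apply, Finset.prod_const, hcard, mul_one, zero_add, hG,
    Real.Gamma_one, pi_rpow_half] at h
  rw [characteristicFunction, dualCone_coneQ, h, ← mul_pow]
  congr 2
  rw [← mul_div_assoc, Real.mul_self_sqrt Real.pi_pos.le]

end PathCone

end

theorem theorem4p2 (n : ℕ) (hn : 1 ≤ n) :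
    (∀ (M : Fin n) (s : Fin n → ℝ) (η : Matrix (Fin n) (Fin n) ℝ), η ∈ PathCone.coneQ n →
      (MeasureTheory.IntegrableOn
          (fun c => Real.exp (-(PathCone.ofCoords n c * η).trace) *
            PathCone.powerP M s (PathCone.ofCoords n c))
          (PathCone.ofCoords n ⁻¹' PathCone.coneP n) ↔
        (∀ i, i ≠ M → -(3 / 2) < s i) ∧ -1 < s M) ∧
      ((∀ i, i ≠ M → -(3 / 2) < s i) ∧ -1 < s M →
        ∫ c in PathCone.ofCoords n ⁻¹' PathCone.coneP n,
            Real.exp (-(PathCone.ofCoords n c * η).trace) *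
              PathCone.powerP M s (PathCone.ofCoords n c) =
          Real.pi ^ (((n : ℝ) - 1) / 2) * (∏ i with i ≠ M, Real.Gamma (s i + 3 / 2)) *
            Real.Gamma (s M + 1) * PathCone.powerQ M (-s) η * PathCone.phi n η)) ∧
    (∀ η ∈ PathCone.coneQ n,
      PathCone.characteristicFunction (PathCone.coneQ n) η =
        (Real.pi / 2) ^ (n - 1) * PathCone.phi n η) := by
  obtain ⟨n, rfl⟩ := Nat.exists_eq_add_of_le' hn
  exact ⟨fun M s η hη => ⟨PathCone.integrableOn_coneP_iff M s (PathCone.edgePos_of_mem_coneQ hη),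
    PathCone.integral_coneP M s (PathCone.edgePos_of_mem_coneQ hη)⟩,
    fun η hη => PathCone.characteristicFunction_coneQ (PathCone.edgePos_of_mem_coneQ hη)⟩
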